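/- Let $L$ be an algebraic extension of $\mathbb{Q}$ (possibly of infinite degree) and let $L/K$ be a Galois extension (possibly infinite). Let $\hat{\hat{\mathbb S}}_L$ be the (proto) adele class group of $L$: the compact abelian group whose character group is $(L,+)$ (for $L/\mathbb{Q}$ finite it is $\mathbb{A}_L/L$; in general it is the inverse limit of the groups $\mathbb{A}_F/F$ along the trace maps, $F\subset L$ finite over $\mathbb Q$), with its Haar probability measure and characters $\phi_\alpha$, $\alpha\in L$. Let $\mathsf{H}_\bullet[L]$ be the graded Hardy space, i.e. the Hilbert space of series $F=\sum_{\alpha\in L}a_\alpha\varrho^\alpha$ with boundary value $\sum_\alpha a_\alpha\phi_\alpha\in L^2(\hat{\hat{\mathbb S}}_L,\mathbb{C})$. It is graded by the signs of the non-zero elements of $L$ at all infinite places: the sign of a non-zero complex number records on which of the four open half axes, or in which of the four open quadrants, it lies (for a real number: whether it is positive or negative), the sign of $\alpha$ is the family of the signs of its images under all embeddings $L\to\mathbb C$, $\mho_L$ is the set of the signs of the non-zero elements, and $\mathsf H_\vartheta[L]$, for $\vartheta\in\mho_L$, consists of the series with $a_\alpha=0$ unless $\alpha\ne0$ has sign $\vartheta$.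 Thus $\mathsf H_\bullet[L]$ is the Hilbert sum of the $\mathsf H_\vartheta[L]$ and of the constants $\mathbb C\varrho^0$. For $F=\sum a_\alpha\varrho^\alpha$ and $G=\sum b_\alpha\varrho^\alpha$ put $$F\oplus G=\sum_\alpha\Big(\sum_{\alpha_1+\alpha_2=\alpha}a_{\alpha_1}b_{\alpha_2}\Big)\varrho^\alpha,\qquad F\otimes G=\sum_\alpha\Big(\sum_{\alpha_1\alpha_2=\alpha}a_{\alpha_1}b_{\alpha_2}\Big)\varrho^\alpha ,$$ defined whenever the coefficients on the right are square summable and, for $\otimes$, the inner sum with $\alpha=0$ converges absolutely. Let $\mathsf{N}_\bullet[L]\subset\mathbb{P}\mathsf{H}_\bullet[L]$ be the set of classes $[F]$ of all $F\neq0$ except those for which $\sum|a_\alpha|<\infty$ and $\sum a_\alpha=0$, with the induced partial operations $[F]\oplus[G]$ and $[F]\otimes[G]$, and let $\mathsf{N}_\bullet[K]\subset\mathsf{N}_\bullet[L]$ consist of the classes of the series with $a_\alpha=0$ for all $\alpha\notin K$. A nonlinear automorphism of $\mathsf{N}_\bullet[L]$ is a bijection $\Upsilon$ of $\mathsf{N}_\bullet[L]$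 that is the restriction of a bijective Fubini–Study isometry of $\mathbb{P}\mathsf{H}_\bullet[L]$ carrying $\mathbb{P}\mathsf{H}_\vartheta[L]$ onto $\mathbb{P}\mathsf{H}_{\iota(\vartheta)}[L]$ for all $\vartheta\in\mho_L$, for some permutation $\iota$ of $\mho_L$, and that satisfies $\Upsilon([F]\oplus[G])=\Upsilon([F])\oplus\Upsilon([G])$ and $\Upsilon([F]\otimes[G])=\Upsilon([F])\otimes\Upsilon([G])$ whenever the left-hand products are defined in $\mathsf N_\bullet[L]$ (the right-hand products then being required to be defined). Let $\mathsf{Gal}(\mathsf{N}_\bullet[L]/\mathsf{N}_\bullet[K])$ be the set of nonlinear automorphisms of $\mathsf{N}_\bullet[L]$ fixing every point of $\mathsf{N}_\bullet[K]$, with composition. Then $\mathsf{Gal}(\mathsf{N}_\bullet[L]/\mathsf{N}_\bullet[K])$ is a group, and $$\mathsf{Gal}(\mathsf{N}_\bullet[L]/\mathsf{N}_\bullet[K])\;\cong\;\mathrm{Gal}(L/K);$$ more precisely, each $\Upsilon$ in it permutes the monomial classes, $\Upsilon([\varrho^\alpha])=[\varrho^{\sigma(\alpha)}]$ for all $\alpha\in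 L$ with some $\sigma\in\mathrm{Gal}(L/K)$, and $\Upsilon\mapsto\sigma$ is an isomorphism. -/

import Mathlib

open MeasureTheory
open scoped LinearAlgebra.Projectivization ENNReal

noncomputable section

namespace NonlinearNumberField

/-! ### The proto adele class group and its characters -/

/-- The additive group of the field `L`, written multiplicatively. It carries the discrete
topology. -/
def CharField (L : Type*) : Type _ := Multiplicative L

instance (L : Type*) [Field L] : CommGroup (CharField L) :=
  inferInstanceAs (CommGroup (Multiplicative L))

instance (L : Type*) : TopologicalSpace (CharField L) := ⊥

instance (L : Type*) : DiscreteTopology (CharField L) := ⟨rfl⟩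

/-- The (proto) adele class group of an algebraic extension `L / ℚ`: the compact abelian group
whose (discrete) character group is `(L, +)`, i.e. the Pontryagin dual of `(L, +)`. For `L / ℚ`
finite this is the classical adele class group `𝔸_L / L`, and in general it is the inverse limit
of the groups `𝔸_F / F` along the trace maps, `F` running through the finite subextensions. -/
abbrev ProtoAdeleClassGroup (L : Type*) [Field L] : Type _ := PontryaginDual (CharField L)

instance (L : Type*) [Field L] : MeasurableSpace (ProtoAdeleClassGroup L) := borel _

instance (L : Type*) [Field L] : BorelSpace (ProtoAdeleClassGroup L) := ⟨rfl⟩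

/-- The Haar measure of total mass one. -/
def haarProb (L : Type*) [Field L] : Measure (ProtoAdeleClassGroup L) :=
  Measure.haarMeasure ⊤

instance (L : Type*) [Field L] : (haarProb L).IsHaarMeasure :=
  inferInstanceAs (Measure.haarMeasure ⊤).IsHaarMeasure

instance (L : Type*) [Field L] : IsProbabilityMeasure (haarProb L) :=
  ⟨by
    have h := Measure.haarMeasure_self (K₀ := (⊤ : TopologicalSpace.PositiveCompacts
      (ProtoAdeleClassGroup L)))
    simpa [haarProb] using h⟩

/-- The character `φ_α` of the proto adele class group attached to `α ∈ L`. -/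
def character {L : Type*} [Field L] (α : L) : C(ProtoAdeleClassGroup L, ℂ) where
  toFun χ := ((χ (Multiplicative.ofAdd α : Multiplicative L) : Circle) : ℂ)
  continuous_toFun := by
    refine continuous_subtype_val.comp ?_
    exact (continuous_eval_const (F := C(CharField L, Circle))
      (Multiplicative.ofAdd α : Multiplicative L)).comp
      (ContinuousMonoidHom.isInducing_toContinuousMap (CharField L) Circle).continuous

/-! ### The graded Hardy space -/

/-- The Hilbert space `H_•[L]` of graded holomorphic functions. A graded holomorphic function is
given by its boundary value, which is an arbitrary square integrable function on the proto adele
class group; the inner product is that of the boundary values. -/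
abbrev HardySpace (L : Type*) [Field L] : Type _ := Lp ℂ 2 (haarProb L)

/-- The monomial `ϱ ^ α`: the element of `H_•[L]` with boundary value the character `φ_α`. -/
def monomial {L : Type*} [Field L] (α : L) : HardySpace L :=
  ContinuousMap.toLp 2 (haarProb L) ℂ (character α)

/-- The Fourier coefficient `a_α` in the development `F = ∑ a_α ϱ ^ α`. -/
def coeff {L : Type*} [Field L] (F : HardySpace L) (α : L) : ℂ := inner ℂ (monomial α) F

lemma coeff_add {L : Type*} [Field L] (F G : HardySpace L) (α : L) :
    coeff (F + G) α = coeff F α + coeff G α := inner_add_right _ _ _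

lemma coeff_smul {L : Type*} [Field L] (c : ℂ) (F : HardySpace L) (α : L) :
    coeff (c • F) α = c * coeff F α := inner_smul_right _ _ _

lemma coeff_zero {L : Type*} [Field L] (α : L) : coeff (0 : HardySpace L) α = 0 :=
  inner_zero_right _

lemma exists_character_ne_one {L : Type*} [Field L] [CharZero L] {γ : L} (hγ : γ ≠ 0) :
    ∃ χ : ProtoAdeleClassGroup L, character γ χ ≠ 1 := by
  obtain ⟨f, hf⟩ : ∃ f : Module.Dual ℚ L, f γ ≠ 0 := by
    by_contra! h
    exact hγ ((Module.forall_dual_apply_eq_zero_iff ℚ γ).1 h)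
  let ψ : Multiplicative L →* Circle :=
    { toFun := fun x => Circle.exp (Real.pi * ((f x.toAdd / f γ : ℚ) : ℝ))
      map_one' := by simp
      map_mul' := fun x y => by
        rw [← Circle.exp_add]
        congr 1
        simp only [toAdd_mul, map_add]
        push_cast
        ring }
  let χ : ContinuousMonoidHom (CharField L) Circle :=
    { toMonoidHom := ψ
      continuous_toFun := continuous_of_discreteTopology }
  refine ⟨χ, ?_⟩
  have h1 : character γ χ = ((Circle.exp (Real.pi * ((f γ / f γ : ℚ) : ℝ)) : Circle) : ℂ) := rfl
  rw [h1, div_self hf]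
  simp [Circle.coe_exp]
  norm_num

lemma character_mul {L : Type*} [Field L] (γ : L) (χ ψ : ProtoAdeleClassGroup L) :
    character γ (χ * ψ) = character γ χ * character γ ψ := rfl

lemma character_sub {L : Type*} [Field L] (α β : L) (χ : ProtoAdeleClassGroup L) :
    character (β - α) χ = character β χ * (starRingEnd ℂ) (character α χ) := by
  have h : (χ (Multiplicative.ofAdd (β - α) : Multiplicative L) : Circle) =
      χ (Multiplicative.ofAdd β : Multiplicative L) /
        χ (Multiplicative.ofAdd α : Multiplicative L) :=
    map_div χ (Multiplicative.ofAdd β : Multiplicative L) (Multiplicative.ofAdd α : Multiplicative L)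
  change ((χ (Multiplicative.ofAdd (β - α) : Multiplicative L) : Circle) : ℂ) = _
  rw [h, div_eq_mul_inv, Circle.coe_mul, Circle.coe_inv_eq_conj]
  rfl

lemma integral_character {L : Type*} [Field L] [CharZero L] {γ : L} (hγ : γ ≠ 0) :
    ∫ χ, character γ χ ∂(haarProb L) = 0 := by
  obtain ⟨ψ, hψ⟩ := exists_character_ne_one hγ
  have h : ∫ χ, character γ (ψ * χ) ∂(haarProb L) = ∫ χ, character γ χ ∂(haarProb L) :=
    integral_mul_left_eq_self (fun χ => character γ χ) ψ
  simp only [character_mul, integral_const_mul] at h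
  have h2 : (character γ ψ - 1) * ∫ χ, character γ χ ∂(haarProb L) = 0 := by
    rw [sub_mul, h]; ring
  exact (mul_eq_zero.1 h2).resolve_left (sub_ne_zero.2 hψ)

open Classical in
lemma coeff_monomial {L : Type*} [Field L] [CharZero L] (α β : L) :
    coeff (monomial β) α = if α = β then 1 else 0 := by
  have h : coeff (monomial β) α = ∫ χ, character (β - α) χ ∂(haarProb L) := by
    rw [coeff, monomial, monomial, ContinuousMap.inner_toLp]
    simp only [character_sub]
  rw [h]
  split_ifs with hab
  · subst hab
    have h1 : ∀ χ : ProtoAdeleClassGroup L, character (α - α) χ = 1 := fun χ => by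
      have : (χ (1 : CharField L) : Circle) = 1 := map_one χ
      change ((χ (Multiplicative.ofAdd (α - α) : Multiplicative L) : Circle) : ℂ) = 1
      rw [sub_self]
      change ((χ (1 : CharField L) : Circle) : ℂ) = 1
      rw [this, Circle.coe_one]
    simp only [h1]
    simp
  · exact integral_character (sub_ne_zero.2 (Ne.symm hab))

/-- The sign of `α ∈ L` at all infinite places, i.e. at all embeddings `v : L → ℂ`. The sign of a
complex number is the pair of the signs of its real and imaginary part: a non-zero number has one
of eight signs, telling on which open half axis (singular signs) or in which open quadrant (complex
signs) it lies. At a real embedding this is the usual sign. Conjugate embeddings carry the same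
information, so it does not matter that both of them are used. -/
def signVector {L : Type*} [Field L] (α : L) : (L →+* ℂ) → SignType × SignType :=
  fun v => (SignType.sign (v α).re, SignType.sign (v α).im)

/-- The set of the sign vectors of the non-zero elements of `L`; it indexes the grading. -/
def signSet (L : Type*) [Field L] : Set ((L →+* ℂ) → SignType × SignType) :=
  {ϑ | ∃ α : L, α ≠ 0 ∧ signVector α = ϑ}

/-- The summand `H_ϑ[L]` of `H_•[L]`: the Hardy space of `ϑ`-holomorphic functions, consisting of
the series `∑ a_α ϱ ^ α` over the non-zero `α` with sign `ϑ`. -/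
def gradedPart {L : Type*} [Field L] (ϑ : (L →+* ℂ) → SignType × SignType) :
    Submodule ℂ (HardySpace L) where
  carrier := {F | ∀ α, ¬ (α ≠ 0 ∧ signVector α = ϑ) → coeff F α = 0}
  zero_mem' := fun α _ => coeff_zero α
  add_mem' := fun hF hG α hα => by rw [coeff_add, hF α hα, hG α hα, add_zero]
  smul_mem' := fun c F hF α hα => by rw [coeff_smul, hF α hα, mul_zero]

/-! ### The Cauchy and the Dirichlet product -/

/-- `F ⊕ G` is defined and equal to `H`. The sums converge absolutely, being inner products, and
`F ⊕ G` is defined when they are the Fourier coefficients of an element of `H_•[L]`. -/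
def IsCauchyProduct {L : Type*} [Field L] (F G H : HardySpace L) : Prop :=
  ∀ α, coeff H α = ∑' β, coeff F β * coeff G (α - β)

/-- `F ⊗ G` is defined and equal to `H`. The sums for `α ≠ 0` converge absolutely, being inner
products; for `α = 0` absolute convergence is required. -/
def IsDirichletProduct {L : Type*} [Field L] (F G H : HardySpace L) : Prop :=
  (Summable fun x : {x : L × L // x.1 * x.2 = 0} => ‖coeff F x.1.1 * coeff G x.1.2‖) ∧
  ∀ α, coeff H α = ∑' x : {x : L × L // x.1 * x.2 = α}, coeff F x.1.1 * coeff G x.1.2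

/-- A relation between vectors (such as `F ⊕ G = H`) induces one between points of the projective
space (such as `[F] ⊕ [G] = [H]`). -/
def ProjRel {L : Type*} [Field L] (R : HardySpace L → HardySpace L → HardySpace L → Prop)
    (p q r : ℙ ℂ (HardySpace L)) : Prop :=
  ∃ (F G H : HardySpace L) (hF : F ≠ 0) (hG : G ≠ 0) (hH : H ≠ 0),
    p = Projectivization.mk ℂ F hF ∧ q = Projectivization.mk ℂ G hG ∧
    r = Projectivization.mk ℂ H hH ∧ R F G H

/-! ### The nonlinear number field -/

/-- The kernel `I_L` of the trace `T(F) = ∑ a_α`, which is defined on the series with absolutely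
summable coefficients. -/
def traceKernel (L : Type*) [Field L] : Submodule ℂ (HardySpace L) where
  carrier := {F | (Summable fun α => ‖coeff F α‖) ∧ ∑' α, coeff F α = 0}
  zero_mem' := by simp [coeff_zero]
  add_mem' := fun {F G} hF hG => by
    refine ⟨?_, ?_⟩
    · refine Summable.of_nonneg_of_le (fun _ => norm_nonneg _) (fun α => ?_) (hF.1.add hG.1)
      rw [coeff_add]
      exact norm_add_le _ _
    · simp only [coeff_add]
      rw [hF.1.of_norm.tsum_add hG.1.of_norm, hF.2, hG.2, add_zero]
  smul_mem' := fun c F hF => by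
    refine ⟨?_, ?_⟩
    · simp only [coeff_smul, norm_mul]
      exact hF.1.mul_left _
    · simp only [coeff_smul]
      rw [tsum_mul_left, hF.2, mul_zero]

/-- The nonlinear number field `N_•[L]`: the image in the projective space of the complement of the
trace kernel. -/
def NField (L : Type*) [Field L] : Set (ℙ ℂ (HardySpace L)) :=
  {p | p.rep ∉ traceKernel L}

/-- The nonlinear number field `N_•[K]` inside `N_•[L]`: its points are the classes of the series
`∑ a_α ϱ ^ α` with `α` running over `K` only. -/
def subNField (K L : Type*) [Field K] [Field L] [Algebra K L] : Set (NField L) :=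
  {p | ∀ α : L, α ∉ Set.range (algebraMap K L) → coeff p.1.rep α = 0}

lemma monomial_ne_zero {L : Type*} [Field L] [CharZero L] (α : L) :
    (monomial α : HardySpace L) ≠ 0 := fun h => by
  have h1 := coeff_monomial α α
  rw [h, coeff_zero, if_pos rfl] at h1
  exact zero_ne_one h1

/-- The point `[ϱ ^ α]` of `N_•[L]`. -/
def monomialPoint {L : Type*} [Field L] [CharZero L] (α : L) : NField L :=
  ⟨Projectivization.mk ℂ (monomial α) (monomial_ne_zero α), by
    obtain ⟨c, hc⟩ := Projectivization.exists_smul_eq_mk_rep ℂ (monomial α) (monomial_ne_zero α)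
    intro h
    rw [← hc] at h
    have h2 : monomial α ∈ traceKernel L := by
      have h3 := (traceKernel L).smul_mem (↑c⁻¹ : ℂ) h
      rwa [← Units.smul_def, inv_smul_smul] at h3
    have h4 := h2.2
    simp only [coeff_monomial, tsum_ite_eq] at h4
    exact one_ne_zero h4⟩

/-! ### Nonlinear automorphisms -/

/-- The Fubini–Study distance of two points of the projective space. -/
def fubiniStudy {L : Type*} [Field L] (p q : ℙ ℂ (HardySpace L)) : ℝ :=
  Real.arccos (‖(inner ℂ p.rep q.rep : ℂ)‖ / (‖p.rep‖ * ‖q.rep‖))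

/-- A graded Fubini–Study isometry of the projective space `ℙ H_•[L]`. -/
structure IsGradedIsometry {L : Type*} [Field L] (e : Equiv.Perm (ℙ ℂ (HardySpace L))) : Prop where
  isometry : ∀ p q, fubiniStudy (e p) (e q) = fubiniStudy p q
  graded : ∃ ι : Equiv.Perm (signSet L), ∀ ϑ : signSet L,
    e '' {p | p.rep ∈ gradedPart ϑ.1} = {p | p.rep ∈ gradedPart (ι ϑ).1}

/-- A nonlinear automorphism of `N_•[L]`: the restriction of a graded Fubini–Study isometry that
respects `⊕` and `⊗` whenever they are defined in `N_•[L]`. -/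
structure IsNonlinearAut {L : Type*} [Field L] (Υ : Equiv.Perm (NField L)) : Prop where
  restriction : ∃ e : Equiv.Perm (ℙ ℂ (HardySpace L)),
    IsGradedIsometry e ∧ ∀ p : NField L, e p.1 = (Υ p).1
  cauchy : ∀ p q r : NField L, ProjRel IsCauchyProduct p.1 q.1 r.1 →
    ProjRel IsCauchyProduct (Υ p).1 (Υ q).1 (Υ r).1
  dirichlet : ∀ p q r : NField L, ProjRel IsDirichletProduct p.1 q.1 r.1 →
    ProjRel IsDirichletProduct (Υ p).1 (Υ q).1 (Υ r).1

lemma IsNonlinearAut.one {L : Type*} [Field L] : IsNonlinearAut (1 : Equiv.Perm (NField L)) where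
  restriction := ⟨1, ⟨fun _ _ => rfl, 1, fun ϑ => by simp⟩, fun _ => rfl⟩
  cauchy := fun _ _ _ h => h
  dirichlet := fun _ _ _ h => h

lemma IsNonlinearAut.mul {L : Type*} [Field L] {Υ Υ' : Equiv.Perm (NField L)}
    (h : IsNonlinearAut Υ) (h' : IsNonlinearAut Υ') : IsNonlinearAut (Υ * Υ') where
  restriction := by
    obtain ⟨e, ⟨he, ι, hι⟩, hr⟩ := h.restriction
    obtain ⟨e', ⟨he', ι', hι'⟩, hr'⟩ := h'.restriction
    refine ⟨e * e', ⟨fun p q => ?_, ι * ι', fun ϑ => ?_⟩, fun p => ?_⟩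
    · rw [Equiv.Perm.mul_apply, Equiv.Perm.mul_apply, he, he']
    · rw [Equiv.Perm.coe_mul, Set.image_comp, hι', hι, Equiv.Perm.mul_apply]
    · rw [Equiv.Perm.mul_apply, hr', hr, Equiv.Perm.mul_apply]
  cauchy := fun p q r hp => h.cauchy _ _ _ (h'.cauchy _ _ _ hp)
  dirichlet := fun p q r hp => h.dirichlet _ _ _ (h'.dirichlet _ _ _ hp)

/-- `Gal(N_•[L] / N_•[K])`: the nonlinear automorphisms of `N_•[L]` that fix every point of
`N_•[K]`, under composition. The operations being partial, it is not built into the definition that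
the inverse of an automorphism respects them too; an isomorphism with a group shows that it does. -/
def nonlinearGal (K L : Type*) [Field K] [Field L] [Algebra K L] :
    Submonoid (Equiv.Perm (NField L)) where
  carrier := {Υ | IsNonlinearAut Υ ∧ ∀ p ∈ subNField K L, Υ p = p}
  one_mem' := ⟨IsNonlinearAut.one, fun _ _ => rfl⟩
  mul_mem' := fun {Υ Υ'} h h' => ⟨h.1.mul h'.1, fun p hp => by
    rw [Equiv.Perm.mul_apply, h'.2 p hp, h.2 p hp]⟩

end NonlinearNumberField

end

/-!
A nonlinear automorphism `Υ` over `N_•[K]` comes with a Fubini–Study isometry `e` of the whole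
projective space and fixes the classes of `ϱ ^ q` for `q ∈ K`; write `Υ [ϱ ^ α] = [F_α]`.

*Monomial classes go to monomial classes* (`exists_apply_monomialPoint_eq`). As `ϱ ^ α - ϱ ^ 0` lies
in the trace kernel and `Υ` is onto, `e` maps its class to the class of a vector `R` of the trace
kernel. Being a surjective isometry, `e` preserves orthogonality, so `R` is a combination of
`F_α` and `ϱ ^ 0`; hence the coefficients of `F_α` are absolutely summable. Fix an injective
homomorphism `h : L → ℝ` and replace a series `∑ a_β ϱ ^ β` by the almost periodic function
`f(t) = ∑ a_β exp (i h(β) t)`. This turns `⊕` into the pointwise product, and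
`ϱ ^ n ⊗ ·` into the dilation `f(t) ↦ f(n t)`.
Since `ϱ ^ n ⊗ ϱ ^ α` is the `n`-th `⊕`-power of `ϱ ^ α`, the function `f` of `F_α` satisfies
`f(t) ^ n = c_n f(n t)`, and similarly `f(t) f(-t)` is a non-zero constant. Thus `f / f(0)` is
multiplicative on rational arguments and, by continuity, a homomorphism on `ℝ`. Uniqueness of the
coefficients of almost periodic series then leaves room for only one non-zero coefficient
(`exists_eq_zero_of_apSeries_pow`). The induced map on exponents is additive, multiplicative and the
identity on `K`, hence an element of `Gal(L/K)`.

*Injectivity* (`eq_of_apply_monomialPoint_eq`). Because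
`ϱ ^ 0 + c ϱ ^ α = ϱ ^ α ⊗ (ϱ ^ 0 + c ϱ ^ 1)`, the images of the monomials determine
those of the binomials `ϱ ^ 0 + c ϱ ^ α`, and an isometry fixing all monomial classes and
the binomial classes with `c = 1, i` is the identity (`isometry_eq_id`).
The binomials with `c = i` are what excludes antiunitary maps.

*Surjectivity* (`permuteNField_mem_nonlinearGal`). The monomials form a Hilbert basis
(`monomialBasis`), and permuting them by an element of `Gal(L/K)` is a unitary operator that
respects all the structure; it acts on the grading by precomposing the embeddings `L → ℂ`.
-/

noncomputable section

namespace NonlinearNumberField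

/-! ### Completeness of the monomials -/

lemma character_zero {L : Type*} [Field L] : character (0 : L) = 1 := by
  ext χ
  have : (χ (1 : CharField L) : Circle) = 1 := map_one χ
  change ((χ (1 : CharField L) : Circle) : ℂ) = 1
  rw [this, Circle.coe_one]

lemma character_add {L : Type*} [Field L] (α β : L) :
    character (α + β) = character α * character β := by
  ext χ
  have h : (χ (Multiplicative.ofAdd (α + β) : Multiplicative L) : Circle) =
      χ (Multiplicative.ofAdd α : Multiplicative L) *
        χ (Multiplicative.ofAdd β : Multiplicative L) :=
    map_mul χ (Multiplicative.ofAdd α : Multiplicative L)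
      (Multiplicative.ofAdd β : Multiplicative L)
  change ((χ (Multiplicative.ofAdd (α + β) : Multiplicative L) : Circle) : ℂ) = _
  rw [h, Circle.coe_mul]
  rfl

lemma star_character {L : Type*} [Field L] (α : L) : star (character α) = character (-α) := by
  ext χ
  have h := character_sub α 0 χ
  rw [zero_sub, character_zero] at h
  simpa using h.symm

/-- The trigonometric polynomials on the proto adele class group. -/
def characterSubalgebra (L : Type*) [Field L] :
    StarSubalgebra ℂ C(ProtoAdeleClassGroup L, ℂ) where
  toSubalgebra := Algebra.adjoin ℂ (Set.range (character (L := L)))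
  star_mem' := by
    change Algebra.adjoin ℂ (Set.range (character (L := L))) ≤
      star (Algebra.adjoin ℂ (Set.range (character (L := L))))
    refine Algebra.adjoin_le ?_
    rintro - ⟨α, rfl⟩
    exact Algebra.subset_adjoin ⟨-α, (star_character α).symm⟩

lemma characterSubalgebra_coe (L : Type*) [Field L] :
    Subalgebra.toSubmodule (characterSubalgebra L).toSubalgebra =
      Submodule.span ℂ (Set.range (character (L := L))) := by
  apply Algebra.adjoin_eq_span_of_subset
  refine Set.Subset.trans ?_ Submodule.subset_span
  intro x hx
  refine Submonoid.closure_induction (fun _ => id) ⟨0, character_zero⟩ ?_ hx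
  rintro - - - - ⟨α, rfl⟩ ⟨β, rfl⟩
  exact ⟨α + β, character_add α β⟩

lemma characterSubalgebra_separatesPoints (L : Type*) [Field L] :
    (characterSubalgebra L).SeparatesPoints := by
  intro χ ψ hχψ
  by_contra! h
  refine hχψ (DFunLike.ext _ _ fun x => ?_)
  have := h _ ⟨character (Multiplicative.toAdd (x : Multiplicative L)),
    Algebra.subset_adjoin ⟨_, rfl⟩, rfl⟩
  exact Circle.ext this

lemma span_monomial_closure (L : Type*) [Field L] :
    (Submodule.span ℂ (Set.range (monomial (L := L)))).topologicalClosure = ⊤ := by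
  have h : (Submodule.span ℂ (Set.range (character (L := L)))).topologicalClosure = ⊤ := by
    rw [← characterSubalgebra_coe]
    exact congr_arg (Subalgebra.toSubmodule <| StarSubalgebra.toSubalgebra ·)
      (ContinuousMap.starSubalgebra_topologicalClosure_eq_top_of_separatesPoints _
        (characterSubalgebra_separatesPoints L))
  have : (haarProb L).Regular := inferInstanceAs (Measure.haarMeasure ⊤).Regular
  have h2 := (ContinuousMap.toLp_denseRange ℂ (haarProb L) ℂ
    (p := 2) (by simp)).topologicalClosure_map_submodule h
  rw [Submodule.map_span, ← Set.range_comp] at h2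
  exact h2

section Basis

variable {L : Type*} [Field L] [CharZero L]

lemma orthonormal_monomial : Orthonormal ℂ (monomial (L := L)) := by
  classical
  rw [orthonormal_iff_ite]
  exact fun α β => coeff_monomial α β

/-- The monomials, as a Hilbert basis of the Hardy space. -/
def monomialBasis (L : Type*) [Field L] [CharZero L] : HilbertBasis L ℂ (HardySpace L) :=
  HilbertBasis.mk orthonormal_monomial (span_monomial_closure L).ge

lemma monomialBasis_apply (α : L) : monomialBasis L α = monomial α := by
  simp [monomialBasis]

lemma monomialBasis_repr (F : HardySpace L) (α : L) :
    (monomialBasis L).repr F α = coeff F α := by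
  rw [HilbertBasis.repr_apply_apply, monomialBasis_apply, coeff]

lemma coeff_ext {F G : HardySpace L} (h : ∀ α, coeff F α = coeff G α) : F = G := by
  apply (monomialBasis L).repr.injective
  ext α
  rw [monomialBasis_repr, monomialBasis_repr, h]

@[simp] lemma coeff_monomial_self (α : L) : coeff (monomial α) α = 1 := by
  classical
  rw [coeff_monomial, if_pos rfl]

lemma coeff_monomial_of_ne {α β : L} (h : α ≠ β) : coeff (monomial β) α = 0 := by
  classical
  rw [coeff_monomial, if_neg h]

lemma eq_smul_monomial {F : HardySpace L} {β : L} (h : ∀ γ, γ ≠ β → coeff F γ = 0) :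
    F = coeff F β • monomial β := by
  refine coeff_ext fun γ => ?_
  rw [coeff_smul]
  rcases eq_or_ne γ β with rfl | hγ
  · simp
  · rw [h γ hγ, coeff_monomial_of_ne hγ, mul_zero]

end Basis

/-! ### Points of the projective space -/

section Points

variable {L : Type*} [Field L]

lemma exists_rep_eq_smul {F : HardySpace L} (hF : F ≠ 0) :
    ∃ c : ℂ, c ≠ 0 ∧ (Projectivization.mk ℂ F hF).rep = c • F := by
  obtain ⟨c, hc⟩ := Projectivization.exists_smul_eq_mk_rep ℂ F hF
  exact ⟨c, c.ne_zero, hc.symm⟩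

lemma mk_eq_mk {F G : HardySpace L} (hF : F ≠ 0) (hG : G ≠ 0) {c : ℂ} (h : F = c • G) :
    Projectivization.mk ℂ F hF = Projectivization.mk ℂ G hG :=
  (Projectivization.mk_eq_mk_iff' ℂ F G hF hG).2 ⟨c, h.symm⟩

lemma exists_smul_of_mk_eq_mk {F G : HardySpace L} {hF : F ≠ 0} {hG : G ≠ 0}
    (h : Projectivization.mk ℂ F hF = Projectivization.mk ℂ G hG) :
    ∃ c : ℂ, c ≠ 0 ∧ F = c • G := by
  obtain ⟨c, hc⟩ := (Projectivization.mk_eq_mk_iff' ℂ F G hF hG).1 h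
  refine ⟨c, ?_, hc.symm⟩
  rintro rfl
  exact hF (by rw [← hc, zero_smul])

lemma mk_rep_mem_iff {M : Submodule ℂ (HardySpace L)} {F : HardySpace L} (hF : F ≠ 0) :
    (Projectivization.mk ℂ F hF).rep ∈ M ↔ F ∈ M := by
  obtain ⟨c, hc, h⟩ := exists_rep_eq_smul hF
  rw [h, M.smul_mem_iff hc]

lemma mk_mem_NField_iff {F : HardySpace L} (hF : F ≠ 0) :
    Projectivization.mk ℂ F hF ∈ NField L ↔ F ∉ traceKernel L :=
  (mk_rep_mem_iff hF).not

lemma fubiniStudy_mk {F G : HardySpace L} (hF : F ≠ 0) (hG : G ≠ 0) :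
    fubiniStudy (Projectivization.mk ℂ F hF) (Projectivization.mk ℂ G hG) =
      Real.arccos (‖(inner ℂ F G : ℂ)‖ / (‖F‖ * ‖G‖)) := by
  obtain ⟨c, hc, h⟩ := exists_rep_eq_smul hF
  obtain ⟨d, hd, h'⟩ := exists_rep_eq_smul hG
  rw [fubiniStudy, h, h', inner_smul_left, inner_smul_right, norm_smul, norm_smul, norm_mul,
    norm_mul, RCLike.norm_conj]
  congr 1
  have := norm_ne_zero_iff.2 hc
  have := norm_ne_zero_iff.2 hd
  have := norm_ne_zero_iff.2 hF
  have := norm_ne_zero_iff.2 hG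
  field_simp

/-- Fubini–Study isometries preserve the transition amplitudes. -/
lemma amplitude_eq_of_fubiniStudy_eq {F G F' G' : HardySpace L} {hF : F ≠ 0} {hG : G ≠ 0}
    {hF' : F' ≠ 0} {hG' : G' ≠ 0}
    (h : fubiniStudy (Projectivization.mk ℂ F hF) (Projectivization.mk ℂ G hG) =
      fubiniStudy (Projectivization.mk ℂ F' hF') (Projectivization.mk ℂ G' hG')) :
    ‖(inner ℂ F G : ℂ)‖ / (‖F‖ * ‖G‖) = ‖(inner ℂ F' G' : ℂ)‖ / (‖F'‖ * ‖G'‖) := by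
  have key : ∀ F G : HardySpace L, ‖(inner ℂ F G : ℂ)‖ / (‖F‖ * ‖G‖) ∈ Set.Icc (-1 : ℝ) 1 :=
    fun F G =>
    ⟨by linarith [show 0 ≤ ‖(inner ℂ F G : ℂ)‖ / (‖F‖ * ‖G‖) by positivity],
      div_le_one_of_le₀ (norm_inner_le_norm _ _) (by positivity)⟩
  rw [fubiniStudy_mk, fubiniStudy_mk] at h
  exact Real.arccos_injOn (key F G) (key F' G') h

lemma inner_eq_zero_of_fubiniStudy_eq {F G F' G' : HardySpace L} {hF : F ≠ 0} {hG : G ≠ 0}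
    {hF' : F' ≠ 0} {hG' : G' ≠ 0}
    (h : fubiniStudy (Projectivization.mk ℂ F hF) (Projectivization.mk ℂ G hG) =
      fubiniStudy (Projectivization.mk ℂ F' hF') (Projectivization.mk ℂ G' hG'))
    (h0 : (inner ℂ F G : ℂ) = 0) : (inner ℂ F' G' : ℂ) = 0 := by
  have h1 := amplitude_eq_of_fubiniStudy_eq h
  rw [h0, norm_zero, zero_div, eq_comm, div_eq_zero_iff] at h1
  rcases h1 with h1 | h1
  · exact norm_eq_zero.1 h1
  · exact absurd h1 (mul_ne_zero (norm_ne_zero_iff.2 hF') (norm_ne_zero_iff.2 hG'))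

end Points

/-! ### Absolutely convergent almost periodic series -/

section Series

open Filter Topology Complex

lemma countable_of_isAlgebraic_rat (L : Type*) [Field L] [CharZero L] [Algebra.IsAlgebraic ℚ L] :
    Countable L := by
  refine Set.countable_univ_iff.1 ((Algebraic.countable ℚ L).mono fun x _ => ?_)
  exact Algebra.IsAlgebraic.isAlgebraic x

/-- The additive group of a countable subfield of `ℂ` embeds in `ℝ`: for all but countably many `t`
the real-linear form `z ↦ Re z + t Im z` is injective on it. -/
lemma exists_injective_addMonoidHom (L : Type*) [Field L] [CharZero L] [Countable L]
    [Algebra.IsAlgebraic ℚ L] : ∃ h : L →+ ℝ, Function.Injective h := by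
  let v : L →+* ℂ := (IsAlgClosed.lift : L →ₐ[ℚ] ℂ).toRingHom
  obtain ⟨t, ht⟩ : ∃ t : ℝ, t ∉ Set.range fun β : L => -(v β).re / (v β).im := by
    by_contra! h
    exact not_countable (α := ℝ) (Set.countable_univ_iff.1
      ((Set.countable_range fun β : L => -(v β).re / (v β).im).mono fun x _ => h x))
  refine ⟨{ toFun := fun β => (v β).re + t * (v β).im, map_zero' := by simp,
            map_add' := fun x y => by simp only [map_add, add_re, add_im]; ring }, ?_⟩
  refine (injective_iff_map_eq_zero _).2 fun β hβ => ?_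
  replace hβ : (v β).re + t * (v β).im = 0 := hβ
  have him : (v β).im = 0 := by
    by_contra him
    exact ht ⟨β, by simp only; rw [div_eq_iff him]; linarith⟩
  rw [him, mul_zero, add_zero] at hβ
  exact (map_eq_zero v).1 (Complex.ext hβ him)

/-- The value at `t` of the almost periodic function with coefficients `a` and frequencies `h`. -/
def apSeries {L : Type*} [AddCommGroup L] (h : L →+ ℝ) (a : L → ℂ) (t : ℝ) : ℂ :=
  ∑' β, a β * exp ((h β * t : ℝ) * I)

variable {L : Type*} [AddCommGroup L] {h : L →+ ℝ} {a : L → ℂ}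

lemma norm_mul_exp_ofReal (z : ℂ) (x : ℝ) : ‖z * exp (x * I)‖ = ‖z‖ := by
  rw [norm_mul, norm_exp_ofReal_mul_I, mul_one]

lemma summable_apSeries (ha : Summable fun β => ‖a β‖) (t : ℝ) :
    Summable fun β => a β * exp ((h β * t : ℝ) * I) :=
  Summable.of_norm (by simpa only [norm_mul_exp_ofReal] using ha)

lemma continuous_apSeries (ha : Summable fun β => ‖a β‖) : Continuous (apSeries h a) := by
  refine continuous_tsum (u := fun β => ‖a β‖) (fun β => ?_) ha fun β t => ?_
  · fun_prop
  · rw [norm_mul_exp_ofReal]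

lemma tendsto_mean_exp {x : ℝ} (hx : x ≠ 0) :
    Tendsto (fun T : ℝ => (T : ℂ)⁻¹ * ∫ t in (0 : ℝ)..T, exp ((x * t : ℝ) * I)) atTop (𝓝 0) := by
  have hxI : (x : ℂ) * I ≠ 0 := mul_ne_zero (by exact_mod_cast hx) I_ne_zero
  have hint : ∀ T : ℝ, ∫ t in (0 : ℝ)..T, exp ((x * t : ℝ) * I) =
      (exp ((x * T : ℝ) * I) - 1) / (x * I) := fun T => by
    have := integral_exp_mul_complex (a := 0) (b := T) hxI
    simp only [ofReal_zero, mul_zero, exp_zero] at this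
    rw [show ((x * T : ℝ) : ℂ) * I = x * I * T by push_cast; ring, ← this]
    refine intervalIntegral.integral_congr fun t _ => ?_
    congr 1
    push_cast
    ring
  rw [tendsto_zero_iff_norm_tendsto_zero]
  refine squeeze_zero' (g := fun T : ℝ => T⁻¹ * (2 / |x|))
    (Eventually.of_forall fun _ => norm_nonneg _) ?_
    (by simpa using tendsto_inv_atTop_zero.mul_const (2 / |x|))
  filter_upwards [eventually_gt_atTop 0] with T hT
  rw [hint, norm_mul, norm_inv, norm_div, norm_mul, norm_I, mul_one, norm_real, norm_real,
    Real.norm_of_nonneg hT.le, Real.norm_eq_abs]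
  gcongr
  calc _ ≤ ‖exp ((x * T : ℝ) * I)‖ + ‖(1 : ℂ)‖ := norm_sub_le _ _
    _ = 2 := by rw [norm_exp_ofReal_mul_I]; norm_num

/-- An absolutely convergent series of exponentials with distinct frequencies determines its
coefficients: they are its mean values against the exponentials. -/
lemma eq_zero_of_apSeries_eq_zero [Countable L] (hh : Function.Injective h)
    (ha : Summable fun β => ‖a β‖) (h0 : ∀ t, apSeries h a t = 0) (γ : L) : a γ = 0 := by
  classical
  -- The terms of the mean value over `[0, T]` of the series times `exp (-i h(γ) t)`.
  set u : ℝ → L → ℂ := fun T β =>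
    a β * ((T : ℂ)⁻¹ * ∫ t in (0 : ℝ)..T, exp (((h β - h γ) * t : ℝ) * I)) with hu
  have hu0 : ∀ T : ℝ, ∑' β, u T β = 0 := fun T => by
    have hs : ∀ t : ℝ, HasSum (fun β => a β * exp (((h β - h γ) * t : ℝ) * I)) 0 := fun t => by
      have := (summable_apSeries (h := h) ha t).hasSum.mul_right (exp (-((h γ * t : ℝ) * I)))
      rw [show ∑' β, a β * exp ((h β * t : ℝ) * I) = 0 from h0 t, zero_mul] at this
      convert! this using 1
      funext β
      rw [mul_assoc, ← exp_add]
      congr 2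
      push_cast
      ring
    have := intervalIntegral.hasSum_integral_of_dominated_convergence (μ := volume)
      (a := 0) (b := T) (F := fun β (t : ℝ) => a β * exp (((h β - h γ) * t : ℝ) * I))
      (f := fun _ => 0) (fun β _ => ‖a β‖)
      (fun β => Continuous.aestronglyMeasurable (by fun_prop))
      (fun β => ae_of_all _ fun t _ => (norm_mul_exp_ofReal _ _).le)
      (ae_of_all _ fun t _ => ha) intervalIntegrable_const (ae_of_all _ fun t _ => hs t)
    simp only [intervalIntegral.integral_const_mul, intervalIntegral.integral_zero] at this
    rw [← mul_zero (T : ℂ)⁻¹, ← (this.mul_left (T : ℂ)⁻¹).tsum_eq]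
    exact tsum_congr fun β => by rw [hu]; ring
  have hlim : Tendsto (fun T => ∑' β, u T β) atTop (𝓝 (∑' β, if β = γ then a γ else 0)) := by
    refine tendsto_tsum_of_dominated_convergence (bound := fun β => ‖a β‖) ha (fun β => ?_) ?_
    · split_ifs with hβ
      · subst hβ
        refine tendsto_const_nhds.congr' ?_
        filter_upwards [eventually_gt_atTop 0] with T hT
        have : (T : ℂ) ≠ 0 := by exact_mod_cast hT.ne'
        simp [hu, this]
      · simpa [hu] using (tendsto_mean_exp (sub_ne_zero.2 (hh.ne hβ))).const_mul (a β)
    · filter_upwards [eventually_gt_atTop 0] with T hT β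
      rw [hu, norm_mul]
      refine mul_le_of_le_one_right (norm_nonneg _) ?_
      have := intervalIntegral.norm_integral_le_of_norm_le_const (a := 0) (b := T) (C := 1)
        (f := fun t : ℝ => exp (((h β - h γ) * t : ℝ) * I))
        fun t _ => (norm_exp_ofReal_mul_I _).le
      rw [norm_mul, norm_inv, norm_real, Real.norm_of_nonneg hT.le, inv_mul_le_one₀ hT]
      simpa [abs_of_pos hT] using this
  simp only [hu0, tsum_ite_eq] at hlim
  exact tendsto_nhds_unique hlim tendsto_const_nhds

/-- A continuous function on `ℝ` that turns integral dilations into powers is a homomorphism. -/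
lemma map_add_of_map_natCast_mul {g : ℝ → ℂ} (hg : Continuous g)
    (hpow : ∀ (n : ℕ) t, g (n * t) = g t ^ n) (hneg : ∀ t, g t * g (-t) = 1) (s t : ℝ) :
    g (s + t) = g s * g t := by
  have h0 : ∀ t, g t ≠ 0 := fun t h => by simpa [h] using hneg t
  have hz : ∀ (m : ℤ) t, g (m * t) = g t ^ m := fun m t => by
    obtain ⟨n, rfl | rfl⟩ := m.eq_nat_or_neg
    · simpa using hpow n t
    · have h1 := hneg (n * t)
      rw [hpow] at h1
      rw [zpow_neg, zpow_natCast, ← eq_inv_of_mul_eq_one_right h1]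
      push_cast
      rw [neg_mul]
  -- Two rationals are integral multiples of a common one.
  have hq : ∀ p q : ℚ, g (p + q) = g p * g q := fun p q => by
    have hp0 : (p.den : ℝ) ≠ 0 := by exact_mod_cast p.den_nz
    have hq0 : (q.den : ℝ) ≠ 0 := by exact_mod_cast q.den_nz
    set u : ℝ := 1 / (p.den * q.den)
    have hp : (p : ℝ) = ((p.num * q.den : ℤ) : ℝ) * u := by
      rw [Rat.cast_def]; simp only [u]; push_cast; field_simp
    have hq : (q : ℝ) = ((q.num * p.den : ℤ) : ℝ) * u := by
      rw [Rat.cast_def]; simp only [u]; push_cast; field_simp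
    rw [hp, hq, ← add_mul, ← Int.cast_add, hz, hz, hz, zpow_add₀ (h0 u)]
  have hd := (Rat.denseRange_cast (𝕜 := ℝ)).prodMap (Rat.denseRange_cast (𝕜 := ℝ))
  have h1 : Continuous fun x : ℝ × ℝ => g (x.1 + x.2) := by fun_prop
  have h2 : Continuous fun x : ℝ × ℝ => g x.1 * g x.2 := by fun_prop
  exact congr_fun (hd.equalizer h1 h2 (funext fun x => hq x.1 x.2)) (s, t)

/-- If an absolutely convergent series of exponentials with distinct frequencies is compatible, up
to constants, with all integral dilations, then only one of its coefficients is non-zero: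
continuity makes the normalized sum a character of `ℝ`, and then translation multiplies all
coefficients by the same number. -/
theorem exists_eq_zero_of_apSeries_pow [Countable L] (hh : Function.Injective h)
    (ha : Summable fun β => ‖a β‖)
    (hpow : ∀ n : ℕ, ∃ c : ℂ, ∀ t, apSeries h a t ^ n = c * apSeries h a (n * t))
    (hneg : ∃ c : ℂ, c ≠ 0 ∧ ∀ t, apSeries h a t * apSeries h a (-t) = c) :
    ∃ β, ∀ γ, γ ≠ β → a γ = 0 := by
  obtain ⟨c, hc, hneg⟩ := hneg
  set f := apSeries h a with hf
  have hf0 : f 0 ≠ 0 := fun h => hc (by rw [← hneg 0, h, zero_mul])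
  have hc2 : f 0 * f 0 = c := by simpa using hneg 0
  have hmul : ∀ s t, f (s + t) * f 0 = f s * f t := by
    have := map_add_of_map_natCast_mul (g := fun t => f t / f 0)
      ((continuous_apSeries ha).div_const _) (fun n t => ?_) (fun t => ?_)
    · intro s t
      have h1 := this s t
      field_simp at h1
      exact h1
    · obtain ⟨d, hd⟩ := hpow n
      have h1 := hd 0
      have h2 := hd t
      rw [mul_zero] at h1
      rw [div_pow, h1, h2]
      have hd0 : d ≠ 0 := fun h => pow_ne_zero n hf0 (by rw [h1, h, zero_mul])
      field_simp
    · rw [div_mul_div_comm, hneg, hc2, div_self hc]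
  -- Translation by `s` acts on the coefficient at `β` by `exp (i h(β) s)`.
  have key : ∀ β s, a β * exp ((h β * s : ℝ) * I) * f 0 = a β * f s := fun β s => by
    have hs1 : Summable fun β => ‖a β * exp ((h β * s : ℝ) * I) * f 0 - a β * f s‖ := by
      refine Summable.of_nonneg_of_le (fun _ => norm_nonneg _) (fun β => norm_sub_le _ _) ?_
      simp only [norm_mul (_ * _) (f 0), norm_mul (a _) (f s), norm_mul_exp_ofReal]
      exact (ha.mul_right _).add (ha.mul_right _)
    refine sub_eq_zero.1 (eq_zero_of_apSeries_eq_zero hh hs1 (fun t => ?_) β)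
    have h1 := (summable_apSeries (h := h) ha (s + t)).hasSum.mul_right (f 0)
    have h2 := (summable_apSeries (h := h) ha t).hasSum.mul_right (f s)
    have h3 := (h1.sub h2).tsum_eq
    rw [show ∑' β, a β * exp ((h β * (s + t) : ℝ) * I) = f (s + t) from rfl,
      show ∑' β, a β * exp ((h β * t : ℝ) * I) = f t from rfl, hmul, mul_comm (f t),
      sub_self] at h3
    rw [apSeries, ← h3]
    refine tsum_congr fun β => ?_
    rw [mul_add (h β), ofReal_add, add_mul, exp_add]
    ring
  obtain ⟨β, hβ⟩ : ∃ β, a β ≠ 0 := by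
    by_contra! h
    exact hf0 (by simp [hf, apSeries, h])
  refine ⟨β, fun γ hγβ => ?_⟩
  by_contra hγ
  have hexp : ∀ s, exp ((h β * s : ℝ) * I) = exp ((h γ * s : ℝ) * I) := fun s => by
    have h1 := key β s
    have h2 := key γ s
    rw [mul_assoc, mul_right_inj' hβ] at h1
    rw [mul_assoc, mul_right_inj' hγ] at h2
    exact mul_right_cancel₀ hf0 (h1.trans h2.symm)
  have hne : h β - h γ ≠ 0 := sub_ne_zero.2 (hh.ne hγβ.symm)
  -- At this `s` the two exponentials are opposite.
  have h1 := hexp (Real.pi / (h β - h γ))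
  have h2 : ((h β * (Real.pi / (h β - h γ)) : ℝ) : ℂ) * I =
      (h γ * (Real.pi / (h β - h γ)) : ℝ) * I + Real.pi * I := by
    rw [← add_mul, ← ofReal_add]
    congr 2
    field_simp
    ring
  rw [h2, exp_add, exp_pi_mul_I, mul_neg_one, neg_eq_iff_add_eq_zero, ← two_mul] at h1
  exact (mul_ne_zero two_ne_zero (exp_ne_zero _)) h1

end Series

/-! ### Products with monomials -/

section Products

variable {L : Type*} [Field L]

lemma projRel_mk {R : HardySpace L → HardySpace L → HardySpace L → Prop} {F G H : HardySpace L}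
    (hF : F ≠ 0) (hG : G ≠ 0) (hH : H ≠ 0) (h : R F G H) :
    ProjRel R (Projectivization.mk ℂ F hF) (Projectivization.mk ℂ G hG)
      (Projectivization.mk ℂ H hH) :=
  ⟨F, G, H, hF, hG, hH, rfl, rfl, rfl, h⟩

/-- By bilinearity of `⊕`, the first two representatives may be prescribed, and the third one up to
a scalar. -/
lemma ProjRel.exists_isCauchyProduct {F G H : HardySpace L} {hF : F ≠ 0} {hG : G ≠ 0} {hH : H ≠ 0}
    (h : ProjRel IsCauchyProduct (Projectivization.mk ℂ F hF) (Projectivization.mk ℂ G hG)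
      (Projectivization.mk ℂ H hH)) : ∃ c : ℂ, c ≠ 0 ∧ IsCauchyProduct F G (c • H) := by
  obtain ⟨F', G', H', hF', hG', hH', h1, h2, h3, h⟩ := h
  obtain ⟨a, ha, rfl⟩ := exists_smul_of_mk_eq_mk h1.symm
  obtain ⟨b, hb, rfl⟩ := exists_smul_of_mk_eq_mk h2.symm
  obtain ⟨d, hd, rfl⟩ := exists_smul_of_mk_eq_mk h3.symm
  refine ⟨(a * b)⁻¹ * d, mul_ne_zero (inv_ne_zero (mul_ne_zero ha hb)) hd, fun α => ?_⟩
  rw [mul_smul, coeff_smul, h, ← tsum_mul_left]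
  refine tsum_congr fun β => ?_
  rw [coeff_smul, coeff_smul]
  field_simp

lemma ProjRel.exists_isDirichletProduct {F G H : HardySpace L} {hF : F ≠ 0} {hG : G ≠ 0}
    {hH : H ≠ 0}
    (h : ProjRel IsDirichletProduct (Projectivization.mk ℂ F hF) (Projectivization.mk ℂ G hG)
      (Projectivization.mk ℂ H hH)) : ∃ c : ℂ, c ≠ 0 ∧ IsDirichletProduct F G (c • H) := by
  obtain ⟨F', G', H', hF', hG', hH', h1, h2, h3, hs, h⟩ := h
  obtain ⟨a, ha, rfl⟩ := exists_smul_of_mk_eq_mk h1.symm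
  obtain ⟨b, hb, rfl⟩ := exists_smul_of_mk_eq_mk h2.symm
  obtain ⟨d, hd, rfl⟩ := exists_smul_of_mk_eq_mk h3.symm
  have key : ∀ x : L × L, coeff F x.1 * coeff G x.2 =
      (a * b)⁻¹ * (coeff (a • F) x.1 * coeff (b • G) x.2) := fun x => by
    rw [coeff_smul, coeff_smul]
    field_simp
  refine ⟨(a * b)⁻¹ * d, mul_ne_zero (inv_ne_zero (mul_ne_zero ha hb)) hd, ?_, fun α => ?_⟩
  · simp only [key, norm_mul (a * b)⁻¹]
    exact hs.mul_left _
  · rw [mul_smul, coeff_smul, h, ← tsum_mul_left]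
    exact tsum_congr fun x => (key x.1).symm

/-- On absolutely summable coefficients the Cauchy product becomes the pointwise product of almost
periodic functions. -/
lemma IsCauchyProduct.apSeries_eq {F G H : HardySpace L} (h : L →+ ℝ)
    (hF : Summable fun α => ‖coeff F α‖) (hG : Summable fun α => ‖coeff G α‖)
    (hH : IsCauchyProduct F G H) (t : ℝ) :
    apSeries h (coeff H) t = apSeries h (coeff F) t * apSeries h (coeff G) t := by
  have hF' : Summable fun β => ‖coeff F β * Complex.exp ((h β * t : ℝ) * Complex.I)‖ := by
    simpa only [norm_mul_exp_ofReal] using hF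
  have hG' : Summable fun β => ‖coeff G β * Complex.exp ((h β * t : ℝ) * Complex.I)‖ := by
    simpa only [norm_mul_exp_ofReal] using hG
  let ε : L × L ≃ L × L :=
    { toFun := fun x => (x.2, x.1 - x.2)
      invFun := fun x => (x.1 + x.2, x.1)
      left_inv := fun x => by simp
      right_inv := fun x => by simp }
  have hs := summable_mul_of_summable_norm hF' hG'
  have hp := (ε.summable_iff.2 hs).tsum_prod
  rw [Function.comp_def] at hp
  rw [apSeries, apSeries, apSeries, tsum_mul_tsum_of_summable_norm hF' hG', ← ε.tsum_eq, hp]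
  refine tsum_congr fun α => ?_
  rw [hH α, ← tsum_mul_right]
  refine tsum_congr fun β => ?_
  simp only [ε, Equiv.coe_fn_mk, map_sub]
  rw [mul_mul_mul_comm, ← Complex.exp_add]
  congr 2
  push_cast
  ring

lemma apSeries_dilate (h : L →+ ℝ) {q : L} (hq : q ≠ 0) {x : ℝ} (hx : ∀ β, h (q * β) = x * h β)
    {G H : HardySpace L} {c : ℂ} (hGH : ∀ β, c * coeff H (q * β) = coeff G β) (t : ℝ) :
    c * apSeries h (coeff H) t = apSeries h (coeff G) (x * t) := by
  rw [apSeries, apSeries, ← (Equiv.mulLeft₀ q hq).tsum_eq, ← tsum_mul_left]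
  refine tsum_congr fun β => ?_
  rw [Equiv.mulLeft₀_apply, ← hGH, hx]
  ring_nf

variable [CharZero L]

/-- `ϱ ^ q ⊕ G` is the translate of `G` by `q`. -/
lemma isCauchyProduct_monomial_left {q : L} {G H : HardySpace L} :
    IsCauchyProduct (monomial q) G H ↔ ∀ β, coeff H (q + β) = coeff G β := by
  have key : ∀ α, ∑' β, coeff (monomial q) β * coeff G (α - β) = coeff G (α - q) := fun α => by
    rw [tsum_eq_single q fun β hβ => by rw [coeff_monomial_of_ne hβ, zero_mul],
      coeff_monomial_self, one_mul]
  simp only [IsCauchyProduct, key]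
  exact ⟨fun h β => by rw [h, add_sub_cancel_left], fun h α => by rw [← h, add_sub_cancel]⟩

/-- For `q ≠ 0`, `ϱ ^ q ⊗ G` is the dilate of `G` by `q`. -/
lemma isDirichletProduct_monomial_left {q : L} (hq : q ≠ 0) {G H : HardySpace L} :
    IsDirichletProduct (monomial q) G H ↔ ∀ β, coeff H (q * β) = coeff G β := by
  have hx : ∀ α (x : {x : L × L // x.1 * x.2 = α}), x ≠ ⟨(q, α / q), mul_div_cancel₀ α hq⟩ →
      coeff (monomial q) x.1.1 * coeff G x.1.2 = 0 := fun α x hx => by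
    rw [coeff_monomial_of_ne, zero_mul]
    rintro h
    refine hx (Subtype.ext (Prod.ext h ?_))
    exact eq_div_of_mul_eq hq ((mul_comm _ _).trans ((congr_arg (· * x.1.2) h.symm).trans x.2))
  have key : ∀ α, ∑' x : {x : L × L // x.1 * x.2 = α}, coeff (monomial q) x.1.1 * coeff G x.1.2 =
      coeff G (α / q) := fun α => by
    rw [tsum_eq_single _ (hx α), coeff_monomial_self, one_mul]
  have hs : Summable fun x : {x : L × L // x.1 * x.2 = 0} =>
      ‖coeff (monomial q) x.1.1 * coeff G x.1.2‖ :=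
    (hasSum_single _ fun x h => by rw [hx 0 x h, norm_zero]).summable
  simp only [IsDirichletProduct, key, hs, true_and]
  exact ⟨fun h β => by rw [h, mul_div_cancel_left₀ _ hq],
    fun h α => by rw [← h, mul_div_cancel₀ _ hq]⟩

lemma monomialPoint_injective : Function.Injective (monomialPoint (L := L)) := fun α β h => by
  obtain ⟨c, hc, h⟩ := exists_smul_of_mk_eq_mk (congr_arg Subtype.val h)
  by_contra hαβ
  have h1 := congr_arg (coeff · α) h
  simp only [coeff_smul, coeff_monomial_self, coeff_monomial_of_ne hαβ, mul_zero] at h1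
  exact one_ne_zero h1

lemma projRel_cauchy_monomial (α β : L) :
    ProjRel IsCauchyProduct (monomialPoint α).1 (monomialPoint β).1 (monomialPoint (α + β)).1 := by
  refine projRel_mk _ _ _ (isCauchyProduct_monomial_left.2 fun γ => ?_)
  classical
  simp only [coeff_monomial, add_right_inj]

lemma projRel_dirichlet_monomial {α : L} (hα : α ≠ 0) (β : L) :
    ProjRel IsDirichletProduct (monomialPoint α).1 (monomialPoint β).1
      (monomialPoint (α * β)).1 := by
  refine projRel_mk _ _ _ ((isDirichletProduct_monomial_left hα).2 fun γ => ?_)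
  classical
  simp only [coeff_monomial, mul_right_inj' hα]

end Products

/-! ### Nonlinear automorphisms permute the monomials -/

section Permute

variable {K L : Type*} [Field K] [Field L] [Algebra K L]

lemma apply_mk_of_fixes {Υ : Equiv.Perm (NField L)} (hΥ : ∀ p ∈ subNField K L, Υ p = p)
    {F : HardySpace L} (hF : F ≠ 0) (hN : Projectivization.mk ℂ F hF ∈ NField L)
    (hK : ∀ α : L, α ∉ Set.range (algebraMap K L) → coeff F α = 0) :
    Υ ⟨_, hN⟩ = ⟨_, hN⟩ := by
  refine hΥ _ fun α hα => ?_
  obtain ⟨c, -, hc⟩ := exists_rep_eq_smul hF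
  rw [hc, coeff_smul, hK α hα, mul_zero]

variable [CharZero L]

lemma apply_monomialPoint_algebraMap {Υ : Equiv.Perm (NField L)}
    (hΥ : ∀ p ∈ subNField K L, Υ p = p) (k : K) :
    Υ (monomialPoint (algebraMap K L k)) = monomialPoint (algebraMap K L k) :=
  apply_mk_of_fixes hΥ _ _ fun _ hα =>
    coeff_monomial_of_ne fun h => hα ⟨k, h.symm⟩

/-- The image of a monomial class has absolutely summable coefficients: `ϱ ^ α - ϱ ^ 0` lies in the
trace kernel, and so does the vector representing its image, which is a linear combination of
`ϱ ^ 0` and of the image of `ϱ ^ α`. -/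
lemma summable_coeff_of_apply_monomialPoint {Υ : Equiv.Perm (NField L)} (hΥ : IsNonlinearAut Υ)
    (h0 : Υ (monomialPoint 0) = monomialPoint 0) (α : L) {F : HardySpace L} {hF : F ≠ 0}
    (hα : (Υ (monomialPoint α)).1 = Projectivization.mk ℂ F hF) :
    Summable fun β => ‖coeff F β‖ := by
  classical
  obtain ⟨e, ⟨he, -⟩, hr⟩ := hΥ.restriction
  have hmono : ∀ β : L, Summable fun γ => ‖coeff (monomial β) γ‖ := fun β => by
    refine (hasSum_single β fun γ hγ => ?_).summable
    rw [coeff_monomial_of_ne hγ, norm_zero]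
  rcases eq_or_ne α 0 with rfl | hα0
  · rw [h0] at hα
    obtain ⟨c, -, rfl⟩ := exists_smul_of_mk_eq_mk hα.symm
    simpa only [coeff_smul, norm_mul] using (hmono 0).mul_left _
  set D : HardySpace L := monomial α - monomial 0 with hD
  have hcD : ∀ γ, coeff D γ = coeff (monomial α) γ - coeff (monomial 0) γ := fun γ =>
    inner_sub_right _ _ _
  have hD0 : D ≠ 0 := fun h => by
    have := hcD α
    rw [h, coeff_zero, coeff_monomial_self, coeff_monomial_of_ne hα0, sub_zero] at this
    exact zero_ne_one this
  have hDI : D ∈ traceKernel L := by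
    refine ⟨?_, ?_⟩
    · refine Summable.of_nonneg_of_le (fun _ => norm_nonneg _) (fun γ => ?_)
        ((hmono α).add (hmono 0))
      rw [hcD]
      exact norm_sub_le _ _
    · simp only [hcD]
      rw [(hmono α).of_norm.tsum_sub (hmono 0).of_norm]
      simp [coeff_monomial]
  have heN : e (Projectivization.mk ℂ D hD0) ∉ NField L := fun hN => by
    obtain ⟨p, hp⟩ := Υ.surjective ⟨_, hN⟩
    have h1 := hr p
    rw [hp] at h1
    have h2 := p.2
    rw [e.injective h1, mk_mem_NField_iff] at h2
    exact h2 hDI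
  set R := (e (Projectivization.mk ℂ D hD0)).rep with hR
  have hRI : R ∈ traceKernel L := not_not.1 heN
  have hR0 : R ≠ 0 := Projectivization.rep_nonzero _
  have heD : e (Projectivization.mk ℂ D hD0) = Projectivization.mk ℂ R hR0 :=
    (Projectivization.mk_rep _).symm
  have heα : e (Projectivization.mk ℂ (monomial α) (monomial_ne_zero α)) =
      Projectivization.mk ℂ F hF := by rw [← hα]; exact hr (monomialPoint α)
  have he0 : e (Projectivization.mk ℂ (monomial 0) (monomial_ne_zero 0)) =
      Projectivization.mk ℂ (monomial 0) (monomial_ne_zero 0) := by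
    have := hr (monomialPoint 0)
    rwa [h0] at this
  -- Every vector orthogonal to `F` and to `ϱ ^ 0` is orthogonal to `R`.
  have hspan : R ∈ Submodule.span ℂ {F, monomial 0} := by
    have : FiniteDimensional ℂ (Submodule.span ℂ {F, (monomial 0 : HardySpace L)}) :=
      FiniteDimensional.span_of_finite ℂ (Set.toFinite _)
    rw [← Submodule.orthogonal_orthogonal (Submodule.span ℂ {F, (monomial 0 : HardySpace L)})]
    refine (Submodule.mem_orthogonal _ _).2 fun w hw => ?_
    rcases eq_or_ne w 0 with rfl | hw0
    · exact inner_zero_left _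
    obtain ⟨q, hq⟩ := e.surjective (Projectivization.mk ℂ w hw0)
    have hq' := Projectivization.mk_rep q
    have h1 : ∀ {A B : HardySpace L} (hA : A ≠ 0) (hB : B ≠ 0),
        e (Projectivization.mk ℂ A hA) = Projectivization.mk ℂ B hB →
        fubiniStudy (Projectivization.mk ℂ q.rep q.rep_nonzero) (Projectivization.mk ℂ A hA) =
          fubiniStudy (Projectivization.mk ℂ w hw0) (Projectivization.mk ℂ B hB) :=
      fun hA hB h => by rw [← h, ← hq, he, hq']
    have hwF : (inner ℂ w F : ℂ) = 0 :=
      Submodule.inner_left_of_mem_orthogonal (Submodule.subset_span (by simp)) hw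
    have hw1 : (inner ℂ w (monomial 0) : ℂ) = 0 :=
      Submodule.inner_left_of_mem_orthogonal (Submodule.subset_span (by simp)) hw
    refine inner_eq_zero_of_fubiniStudy_eq (h1 hD0 hR0 heD) ?_
    rw [hD, inner_sub_right, inner_eq_zero_of_fubiniStudy_eq (h1 _ _ heα).symm hwF,
      inner_eq_zero_of_fubiniStudy_eq (h1 _ _ he0).symm hw1, sub_zero]
  obtain ⟨x, y, hxy⟩ := Submodule.mem_span_pair.1 hspan
  have hc : ∀ γ, coeff R γ = x * coeff F γ + y * coeff (monomial 0) γ := fun γ => by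
    rw [← hxy, coeff_add, coeff_smul, coeff_smul]
  have hx : x ≠ 0 := by
    rintro rfl
    have h1 := hRI.2
    simp only [hc, zero_mul, zero_add, coeff_monomial, mul_ite, mul_one, mul_zero,
      tsum_ite_eq] at h1
    exact hR0 (by rw [← hxy, h1, zero_smul, zero_smul, add_zero])
  have h1 : ∀ γ, coeff F γ = x⁻¹ * (coeff R γ - y * coeff (monomial 0) γ) := fun γ => by
    rw [hc]; field_simp; ring
  simp only [h1, norm_mul]
  refine Summable.mul_left _ (Summable.of_nonneg_of_le (fun _ => norm_nonneg _)
    (fun γ => norm_sub_le _ _) (hRI.1.add ?_))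
  simpa only [norm_mul] using (hmono 0).mul_left _

variable [Algebra.IsAlgebraic ℚ L]

/-- A nonlinear automorphism over `N_•[K]` carries monomial classes to monomial classes. The image
of `ϱ ^ α` is an absolutely convergent series, and since `ϱ ^ n ⊗ ϱ ^ α = ϱ ^ (n α)` is the `n`-th
`⊕`-power of `ϱ ^ α`, dilating it by `n` is the same as taking its `n`-th pointwise power. -/
theorem exists_apply_monomialPoint_eq {Υ : Equiv.Perm (NField L)} (hΥ : Υ ∈ nonlinearGal K L)
    (α : L) : ∃ β : L, Υ (monomialPoint α) = monomialPoint β := by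
  have hcount := countable_of_isAlgebraic_rat L
  obtain ⟨h, hh⟩ := exists_injective_addMonoidHom L
  have hfix := fun k => apply_monomialPoint_algebraMap (K := K) hΥ.2 k
  have h0 : Υ (monomialPoint 0) = monomialPoint 0 := by simpa using hfix 0
  set F : L → HardySpace L := fun γ => (Υ (monomialPoint γ)).1.rep with hFdef
  have hF0 : ∀ γ, F γ ≠ 0 := fun γ => Projectivization.rep_nonzero _
  have hF : ∀ γ, (Υ (monomialPoint γ)).1 = Projectivization.mk ℂ (F γ) (hF0 γ) := fun γ =>
    (Projectivization.mk_rep _).symm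
  have hs : ∀ γ, Summable fun β => ‖coeff (F γ) β‖ := fun γ =>
    summable_coeff_of_apply_monomialPoint hΥ.1 h0 γ (hF γ)
  set f : L → ℝ → ℂ := fun γ => apSeries h (coeff (F γ)) with hf
  have hadd : ∀ γ δ, ∃ c : ℂ, c ≠ 0 ∧ ∀ t, c * f (γ + δ) t = f γ t * f δ t := fun γ δ => by
    have h1 := hΥ.1.cauchy _ _ _ (projRel_cauchy_monomial γ δ)
    rw [hF, hF, hF] at h1
    obtain ⟨c, hc, h2⟩ := h1.exists_isCauchyProduct
    refine ⟨c, hc, fun t => ?_⟩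
    simp only [hf]
    rw [← h2.apSeries_eq h (hs γ) (hs δ), apSeries, apSeries, ← tsum_mul_left]
    exact tsum_congr fun β => by rw [coeff_smul, mul_assoc]
  have hdil : ∀ (n : ℤ), n ≠ 0 → ∃ c : ℂ, c ≠ 0 ∧ ∀ t, c * f (n * α) t = f α (n * t) :=
      fun n hn => by
    have hn' : (n : L) ≠ 0 := by exact_mod_cast hn
    have h1 := hΥ.1.dirichlet _ _ _ (projRel_dirichlet_monomial hn' α)
    rw [show Υ (monomialPoint (n : L)) = monomialPoint (n : L) by simpa using hfix n, hF, hF] at h1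
    obtain ⟨c, hc, h2⟩ := ProjRel.exists_isDirichletProduct h1
    rw [isDirichletProduct_monomial_left hn'] at h2
    refine ⟨c, hc, fun t => apSeries_dilate h hn' (fun β => ?_) (fun β => ?_) t⟩
    · rw [← zsmul_eq_mul, map_zsmul, zsmul_eq_mul]
    · rw [← h2, coeff_smul]
  obtain ⟨c0, hc0, hf0⟩ : ∃ c : ℂ, c ≠ 0 ∧ ∀ t, f 0 t = c := by
    have h1 : Projectivization.mk ℂ (F 0) (hF0 0) =
        Projectivization.mk ℂ (monomial 0) (monomial_ne_zero 0) := by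
      rw [← hF, h0]; rfl
    obtain ⟨c, hc, h2⟩ := exists_smul_of_mk_eq_mk h1
    refine ⟨c, hc, fun t => ?_⟩
    rw [hf]
    simp only [h2, apSeries, coeff_smul]
    rw [tsum_eq_single 0 fun β hβ => by rw [coeff_monomial_of_ne hβ, mul_zero, zero_mul]]
    simp
  have hneg : ∃ c : ℂ, c ≠ 0 ∧ ∀ t, f α t * f α (-t) = c := by
    obtain ⟨c, hc', hc⟩ := hdil (-1) (by norm_num)
    obtain ⟨d, hd, hd'⟩ := hadd α (-α)
    refine ⟨c * (d * c0), mul_ne_zero hc' (mul_ne_zero hd hc0), fun t => ?_⟩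
    have h1 := hd' t
    have h2 := hc t
    simp only [Int.cast_neg, Int.cast_one, neg_mul, one_mul] at h2
    rw [add_neg_cancel, hf0] at h1
    rw [← h2, h1]
    ring
  have hpow : ∀ n : ℕ, ∃ c : ℂ, ∀ t, f α t ^ n = c * f (n * α) t := fun n => by
    induction n with
    | zero => exact ⟨c0⁻¹, fun t => by simp [hf0, hc0]⟩
    | succ n ih =>
      obtain ⟨c, hc⟩ := ih
      obtain ⟨d, -, hd⟩ := hadd (n * α) α
      refine ⟨c * d, fun t => ?_⟩
      rw [pow_succ, hc, mul_assoc, ← hd, Nat.cast_succ, add_mul, one_mul, mul_assoc]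
  have hpow' : ∀ n : ℕ, ∃ c : ℂ, ∀ t, f α t ^ n = c * f α (n * t) := fun n => by
    rcases eq_or_ne n 0 with rfl | hn
    · obtain ⟨c, hc, h1⟩ := hneg
      have h2 : f α 0 ≠ 0 := fun h => hc (by rw [← h1 0, h, zero_mul])
      exact ⟨(f α 0)⁻¹, fun t => by simp [h2]⟩
    · obtain ⟨c, hc⟩ := hpow n
      obtain ⟨d, hd, hd'⟩ := hdil n (by exact_mod_cast hn)
      refine ⟨c * d⁻¹, fun t => ?_⟩
      have h1 := hd' t
      rw [Int.cast_natCast, Int.cast_natCast] at h1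
      rw [hc, ← h1]
      field_simp
  obtain ⟨β, hβ⟩ := exists_eq_zero_of_apSeries_pow hh (hs α) hpow' hneg
  refine ⟨β, Subtype.ext ?_⟩
  rw [hF]
  exact mk_eq_mk _ _ (eq_smul_monomial hβ)

end Permute

/-! ### The Galois automorphism of a nonlinear automorphism -/

section Galois

variable {K L : Type*} [Field K] [Field L] [CharZero L] [Algebra.IsAlgebraic ℚ L] [Algebra K L]

theorem exists_algEquiv_apply_monomialPoint [Algebra.IsAlgebraic K L] {Υ : Equiv.Perm (NField L)}
    (hΥ : Υ ∈ nonlinearGal K L) :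
    ∃ σ : L ≃ₐ[K] L, ∀ α, Υ (monomialPoint α) = monomialPoint (σ α) := by
  choose s hs using exists_apply_monomialPoint_eq hΥ
  have hinj : Function.Injective s := fun α β h =>
    monomialPoint_injective (Υ.injective (by rw [hs, hs, h]))
  have hK : ∀ k : K, s (algebraMap K L k) = algebraMap K L k := fun k =>
    monomialPoint_injective (by rw [← hs, apply_monomialPoint_algebraMap hΥ.2])
  have h0 : s 0 = 0 := by simpa using hK 0
  have hadd : ∀ α β, s (α + β) = s α + s β := fun α β => by
    have h := hΥ.1.cauchy _ _ _ (projRel_cauchy_monomial α β)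
    rw [hs, hs, hs] at h
    obtain ⟨c, hc, h⟩ := ProjRel.exists_isCauchyProduct h
    have h1 := isCauchyProduct_monomial_left.1 h (s β)
    by_contra hne
    rw [coeff_smul, coeff_monomial_of_ne (Ne.symm hne), coeff_monomial_self, mul_zero] at h1
    exact zero_ne_one h1
  have hmul : ∀ α β, s (α * β) = s α * s β := fun α β => by
    rcases eq_or_ne α 0 with rfl | hα
    · rw [zero_mul, h0, zero_mul]
    have hsα : s α ≠ 0 := fun h => hα (hinj (h.trans h0.symm))
    have h := hΥ.1.dirichlet _ _ _ (projRel_dirichlet_monomial hα β)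
    rw [hs, hs, hs] at h
    obtain ⟨c, hc, h⟩ := ProjRel.exists_isDirichletProduct h
    have h1 := (isDirichletProduct_monomial_left hsα).1 h (s β)
    by_contra hne
    rw [coeff_smul, coeff_monomial_of_ne (Ne.symm hne), coeff_monomial_self, mul_zero] at h1
    exact zero_ne_one h1
  let φ : L →ₐ[K] L :=
    { toFun := s
      map_one' := by simpa using hK 1
      map_mul' := hmul
      map_zero' := h0
      map_add' := hadd
      commutes' := hK }
  exact ⟨AlgEquiv.ofBijective φ (Algebra.IsAlgebraic.algHom_bijective φ), hs⟩

end Galois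

/-! ### A nonlinear automorphism is determined by its values on the monomials -/

section Determined

variable {L : Type*} [Field L]

/-- The image of a class under an isometry has a representative `G` of the same norm as the given
one `F`; it then pairs with every vector of fixed class as `F` does, up to a phase. -/
lemma exists_mk_of_isometry {ε : ℙ ℂ (HardySpace L) → ℙ ℂ (HardySpace L)}
    (hε : ∀ p q, fubiniStudy (ε p) (ε q) = fubiniStudy p q) {F : HardySpace L} (hF : F ≠ 0) :
    ∃ (G : HardySpace L) (hG : G ≠ 0),
      ε (Projectivization.mk ℂ F hF) = Projectivization.mk ℂ G hG ∧ ‖G‖ = ‖F‖ ∧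
      ∀ (u : HardySpace L) (hu : u ≠ 0),
        ε (Projectivization.mk ℂ u hu) = Projectivization.mk ℂ u hu →
        ‖(inner ℂ u G : ℂ)‖ = ‖(inner ℂ u F : ℂ)‖ := by
  set G₀ := (ε (Projectivization.mk ℂ F hF)).rep
  have hG₀ : G₀ ≠ 0 := Projectivization.rep_nonzero _
  have hF' := norm_ne_zero_iff.2 hF
  have hG₀' := norm_ne_zero_iff.2 hG₀
  set r : ℂ := ((‖F‖ / ‖G₀‖ : ℝ) : ℂ) with hr
  have hr0 : r ≠ 0 := by
    rw [hr]; exact_mod_cast div_ne_zero hF' hG₀'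
  have hG : r • G₀ ≠ 0 := smul_ne_zero hr0 hG₀
  have hn : ‖r • G₀‖ = ‖F‖ := by
    rw [norm_smul, hr, Complex.norm_real, Real.norm_of_nonneg (by positivity)]
    field_simp
  have heq : ε (Projectivization.mk ℂ F hF) = Projectivization.mk ℂ (r • G₀) hG := by
    rw [mk_eq_mk hG hG₀ rfl]
    exact (Projectivization.mk_rep _).symm
  refine ⟨r • G₀, hG, heq, hn, fun u hu hfix => ?_⟩
  have h1 := hε (Projectivization.mk ℂ u hu) (Projectivization.mk ℂ F hF)
  rw [hfix, heq] at h1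
  have h2 := amplitude_eq_of_fubiniStudy_eq h1
  rw [hn] at h2
  have := norm_ne_zero_iff.2 hu
  field_simp at h2
  exact h2

/-- The vector `ϱ ^ 0 + c ϱ ^ α`. -/
def binomial (c : ℂ) (α : L) : HardySpace L := monomial 0 + c • monomial α

lemma inner_binomial (c : ℂ) (α : L) (F : HardySpace L) :
    inner ℂ (binomial c α) F = coeff F 0 + (starRingEnd ℂ) c * coeff F α := by
  rw [binomial, inner_add_left, inner_smul_left, coeff, coeff]

variable [CharZero L]

open Classical in
lemma coeff_binomial (c : ℂ) (α β : L) :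
    coeff (binomial c α) β = (if β = 0 then 1 else 0) + c * (if β = α then 1 else 0) := by
  rw [binomial, coeff_add, coeff_smul, coeff_monomial, coeff_monomial]

lemma binomial_ne_zero (c : ℂ) {α : L} (hα : α ≠ 0) : binomial c α ≠ 0 := fun h => by
  have := coeff_binomial c α 0
  rw [h, coeff_zero, if_pos rfl, if_neg hα.symm, mul_zero, add_zero] at this
  exact zero_ne_one this

/-- A complex number is determined by its distances from `0`, `-1` and `-i`. -/
lemma complex_eq_of_norm_eq {z w : ℂ} (h0 : ‖z‖ = ‖w‖) (h1 : ‖1 + z‖ = ‖1 + w‖)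
    (h2 : ‖1 - Complex.I * z‖ = ‖1 - Complex.I * w‖) : z = w := by
  have key : ∀ {a b : ℂ}, ‖a‖ = ‖b‖ → a.re * a.re + a.im * a.im = b.re * b.re + b.im * b.im :=
    fun {a b} h => by
      rw [← Complex.normSq_apply, ← Complex.normSq_apply, Complex.normSq_eq_norm_sq, h,
        Complex.normSq_eq_norm_sq]
  have k0 := key h0
  have k1 := key h1
  have k2 := key h2
  simp at k1 k2
  apply Complex.ext <;> linarith

/-- A Fubini–Study isometry fixing the classes of `ϱ ^ α`, `ϱ ^ 0 + ϱ ^ α` and `ϱ ^ 0 + i ϱ ^ α` is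
the identity. -/
theorem isometry_eq_id {ε : ℙ ℂ (HardySpace L) → ℙ ℂ (HardySpace L)}
    (hε : ∀ p q, fubiniStudy (ε p) (ε q) = fubiniStudy p q)
    (hmono : ∀ α : L, ε (monomialPoint α).1 = (monomialPoint α).1)
    (hbin : ∀ c : ℂ, c = 1 ∨ c = Complex.I → ∀ (α : L) (hα : α ≠ 0),
      ε (Projectivization.mk ℂ _ (binomial_ne_zero c hα)) =
        Projectivization.mk ℂ _ (binomial_ne_zero c hα)) (p : ℙ ℂ (HardySpace L)) : ε p = p := by
  have main : ∀ (F : HardySpace L) (hF : F ≠ 0), coeff F 0 ≠ 0 →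
      ε (Projectivization.mk ℂ F hF) = Projectivization.mk ℂ F hF := fun F hF hF0 => by
    obtain ⟨G, hG, heq, -, hamp⟩ := exists_mk_of_isometry hε hF
    have hm : ∀ α, ‖coeff G α‖ = ‖coeff F α‖ := fun α => hamp _ _ (hmono α)
    have hG0 : coeff G 0 ≠ 0 := norm_ne_zero_iff.1 (by rw [hm]; exact norm_ne_zero_iff.2 hF0)
    rw [heq]
    -- Each quotient `coeff G α / coeff G 0` is located by its distances from `0`, `-1` and `-i`.
    refine mk_eq_mk _ _ (c := coeff G 0 / coeff F 0) (coeff_ext fun α => ?_)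
    rw [coeff_smul]
    rcases eq_or_ne α 0 with rfl | hα
    · field_simp
    have hdiv : ∀ {a b : ℂ}, ‖a‖ = ‖b‖ → ‖a / coeff G 0‖ = ‖b / coeff F 0‖ := fun {a b} h => by
      rw [norm_div, norm_div, h, hm]
    have h1 := hamp _ (binomial_ne_zero 1 hα) (hbin 1 (Or.inl rfl) α hα)
    have h2 := hamp _ (binomial_ne_zero Complex.I hα) (hbin _ (Or.inr rfl) α hα)
    rw [inner_binomial, inner_binomial] at h1 h2
    have h3 : coeff G α / coeff G 0 = coeff F α / coeff F 0 := by
      refine complex_eq_of_norm_eq (hdiv (hm α)) ?_ ?_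
      · convert! hdiv h1 using 2 <;> simp <;> field_simp
      · convert! hdiv h2 using 2 <;> simp <;> field_simp <;> ring
    field_simp at h3
    field_simp
    exact h3
  obtain ⟨F, hF, rfl⟩ : ∃ (F : HardySpace L) (hF : F ≠ 0), p = Projectivization.mk ℂ F hF :=
    ⟨p.rep, p.rep_nonzero, (Projectivization.mk_rep p).symm⟩
  by_cases hF0 : coeff F 0 = 0
  · obtain ⟨G, hG, heq, hn, hamp⟩ := exists_mk_of_isometry hε hF
    have hG0 : coeff G 0 = 0 := norm_eq_zero.1 (by
      rw [show ‖coeff G 0‖ = ‖coeff F 0‖ from hamp _ _ (hmono 0), hF0, norm_zero])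
    -- The class of `F + ϱ ^ 0` is fixed, and its amplitude with `F` is as large as possible.
    have hu0 : coeff (F + monomial 0) 0 = 1 := by
      rw [coeff_add, hF0, coeff_monomial_self, zero_add]
    have hu : F + monomial 0 ≠ 0 := fun h => by
      rw [h, coeff_zero] at hu0
      exact zero_ne_one hu0
    have h1 := hamp _ hu (main _ hu (by rw [hu0]; exact one_ne_zero))
    rw [inner_add_left, inner_add_left, show inner ℂ (monomial 0) G = (0 : ℂ) from hG0,
      show inner ℂ (monomial 0) F = (0 : ℂ) from hF0, add_zero, add_zero,
      inner_self_eq_norm_sq_to_K, norm_pow, RCLike.norm_ofReal, abs_norm, sq] at h1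
    obtain ⟨r, -, hr⟩ := (norm_inner_eq_norm_iff hF hG).1 (h1.trans (by rw [hn]))
    rw [heq]
    exact mk_eq_mk _ _ hr
  · exact main F hF hF0

variable {K : Type*} [Field K] [Algebra K L]

lemma binomial_notMem_traceKernel {c : ℂ} (hc : 1 + c ≠ 0) (α : L) :
    binomial c α ∉ traceKernel L := fun h => hc <| by
  classical
  have h2 := h.2
  simp only [coeff_binomial] at h2
  rwa [(hasSum_ite_eq (0 : L) (1 : ℂ)).summable.tsum_add
    ((hasSum_ite_eq α (1 : ℂ)).summable.mul_left c), tsum_mul_left, tsum_ite_eq, tsum_ite_eq,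
    mul_one] at h2

/-- Since `ϱ ^ 0 + c ϱ ^ α = ϱ ^ α ⊗ (ϱ ^ 0 + c ϱ ^ 1)`, the image of its class is determined by
that of `ϱ ^ α`. -/
lemma apply_binomial {Υ : Equiv.Perm (NField L)} (hΥ : Υ ∈ nonlinearGal K L) {c : ℂ}
    (hc : 1 + c ≠ 0) {α β : L} (hα : α ≠ 0) (hβ : β ≠ 0)
    (hαβ : Υ (monomialPoint α) = monomialPoint β) :
    (Υ ⟨Projectivization.mk ℂ _ (binomial_ne_zero c hα),
      (mk_mem_NField_iff _).2 (binomial_notMem_traceKernel hc α)⟩).1 =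
      Projectivization.mk ℂ _ (binomial_ne_zero c hβ) := by
  classical
  have hdil : ∀ {γ : L}, γ ≠ 0 → ∀ δ, coeff (binomial c γ) (γ * δ) = coeff (binomial c 1) δ :=
    fun {γ} hγ δ => by
      simp only [coeff_binomial, mul_eq_zero, hγ, false_or, mul_eq_left₀ hγ]
  have hN : ∀ {γ : L} (hγ : γ ≠ 0), Projectivization.mk ℂ _ (binomial_ne_zero c hγ) ∈ NField L :=
    fun hγ => (mk_mem_NField_iff _).2 (binomial_notMem_traceKernel hc _)
  have h1 := hΥ.1.dirichlet (monomialPoint α) ⟨_, hN one_ne_zero⟩ ⟨_, hN hα⟩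
    (projRel_mk _ _ _ ((isDirichletProduct_monomial_left hα).2 (hdil hα)))
  have hfix : Υ ⟨_, hN one_ne_zero⟩ = ⟨_, hN one_ne_zero⟩ :=
    apply_mk_of_fixes hΥ.2 _ _ fun γ hγ => by
      rw [coeff_binomial, if_neg fun h => hγ ⟨0, by rw [h, map_zero]⟩,
        if_neg fun h => hγ ⟨1, by rw [h, map_one]⟩, mul_zero, add_zero]
  rw [hfix, hαβ] at h1
  set p := (Υ ⟨_, hN hα⟩).1
  rw [← Projectivization.mk_rep p] at h1
  obtain ⟨d, hd, h2⟩ := ProjRel.exists_isDirichletProduct h1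
  rw [isDirichletProduct_monomial_left hβ] at h2
  rw [← Projectivization.mk_rep p]
  refine mk_eq_mk _ _ (c := d⁻¹) ?_
  rw [eq_inv_smul_iff₀ hd]
  refine coeff_ext fun γ => ?_
  rw [← mul_div_cancel₀ γ hβ, h2, hdil hβ]

theorem eq_of_apply_monomialPoint_eq {Υ Υ' : Equiv.Perm (NField L)} (hΥ : Υ ∈ nonlinearGal K L)
    (hΥ' : Υ' ∈ nonlinearGal K L) {s : L → L} (hs : ∀ α, Υ (monomialPoint α) = monomialPoint (s α))
    (hs' : ∀ α, Υ' (monomialPoint α) = monomialPoint (s α)) : Υ = Υ' := by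
  obtain ⟨e, ⟨he, -⟩, hr⟩ := hΥ.1.restriction
  obtain ⟨e', ⟨he', -⟩, hr'⟩ := hΥ'.1.restriction
  have hs0 : ∀ {α}, α ≠ 0 → s α ≠ 0 := fun {α} hα h => hα <| by
    have h0 : Υ (monomialPoint 0) = monomialPoint 0 := by
      simpa using apply_monomialPoint_algebraMap hΥ.2 (0 : K)
    exact monomialPoint_injective (Υ.injective (by rw [hs, h, h0]))
  have key : ∀ p, e'.symm (e p) = p := by
    refine isometry_eq_id (fun p q => ?_) (fun α => ?_) (fun c hc α hα => ?_)
    · rw [← he', Equiv.apply_symm_apply, Equiv.apply_symm_apply, he]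
    · rw [Equiv.symm_apply_eq, hr, hr', hs, hs']
    · have hc' : 1 + c ≠ 0 := by
        rcases hc with rfl | rfl
        · norm_num
        · intro h; simpa using congr_arg Complex.re h
      rw [Equiv.symm_apply_eq]
      have h1 := apply_binomial hΥ hc' hα (hs0 hα) (hs α)
      have h2 := apply_binomial hΥ' hc' hα (hs0 hα) (hs' α)
      rw [← hr] at h1
      rw [← hr'] at h2
      exact h1.trans h2.symm
  refine Equiv.ext fun p => Subtype.ext ?_
  have := key p.1
  rwa [Equiv.symm_apply_eq, hr, hr'] at this

end Determined

/-! ### The nonlinear automorphism of a Galois automorphism -/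

/-- The projective transformation induced by a linear automorphism. -/
def projectivePerm {k V : Type*} [Field k] [AddCommGroup V] [Module k V] (U : V ≃ₗ[k] V) :
    Equiv.Perm (ℙ k V) where
  toFun := Projectivization.map U.toLinearMap U.injective
  invFun := Projectivization.map U.symm.toLinearMap U.symm.injective
  left_inv := Projectivization.ind fun F hF => by simp [Projectivization.map_mk]
  right_inv := Projectivization.ind fun F hF => by simp [Projectivization.map_mk]

lemma projectivePerm_mk {k V : Type*} [Field k] [AddCommGroup V] [Module k V] (U : V ≃ₗ[k] V)
    {F : V} (hF : F ≠ 0) : projectivePerm U (Projectivization.mk k F hF) =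
      Projectivization.mk k (U F) (U.map_ne_zero_iff.2 hF) := rfl

section Permutation

variable {L : Type*} [Field L] [CharZero L]

/-- The unitary operator `∑ a_α ϱ ^ α ↦ ∑ a_α ϱ ^ σ(α)` of the Hardy space. -/
def permuteMonomials (σ : Equiv.Perm L) : HardySpace L ≃ₗᵢ[ℂ] HardySpace L :=
  (monomialBasis L).repr.trans
    (HilbertBasis.mk (orthonormal_monomial.comp σ σ.injective) (by
      rw [σ.surjective.range_comp]; exact (span_monomial_closure L).ge)).repr.symm

@[simp] lemma coeff_permuteMonomials (σ : Equiv.Perm L) (F : HardySpace L) (α : L) :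
    coeff (permuteMonomials σ F) (σ α) = coeff F α := by
  set b := HilbertBasis.mk (orthonormal_monomial.comp σ σ.injective) (by
    rw [σ.surjective.range_comp]; exact (span_monomial_closure L).ge) with hb
  have h1 : b α = monomial (σ α) := by simp [hb]
  rw [coeff, ← h1, ← HilbertBasis.repr_apply_apply, ← monomialBasis_repr]
  simp [permuteMonomials, hb]

lemma permuteMonomials_ne_zero (σ : Equiv.Perm L) {F : HardySpace L} (hF : F ≠ 0) :
    permuteMonomials σ F ≠ 0 := fun h => hF (by simpa using h)

lemma permuteMonomials_monomial (σ : Equiv.Perm L) (α : L) :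
    permuteMonomials σ (monomial α) = monomial (σ α) := by
  classical
  refine coeff_ext fun β => ?_
  obtain ⟨γ, rfl⟩ := σ.surjective β
  rw [coeff_permuteMonomials, coeff_monomial, coeff_monomial, σ.injective.eq_iff]

/-- The projective transformation induced by `permuteMonomials σ`. -/
def permuteClasses (σ : Equiv.Perm L) : Equiv.Perm (ℙ ℂ (HardySpace L)) :=
  projectivePerm (permuteMonomials σ).toLinearEquiv

lemma permuteClasses_mk (σ : Equiv.Perm L) {F : HardySpace L} (hF : F ≠ 0) :
    permuteClasses σ (Projectivization.mk ℂ F hF) =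
      Projectivization.mk ℂ (permuteMonomials σ F) (permuteMonomials_ne_zero σ hF) :=
  projectivePerm_mk _ hF

lemma fubiniStudy_permuteClasses (σ : Equiv.Perm L) (p q : ℙ ℂ (HardySpace L)) :
    fubiniStudy (permuteClasses σ p) (permuteClasses σ q) = fubiniStudy p q := by
  induction p using Projectivization.ind with | _ F hF
  induction q using Projectivization.ind with | _ G hG
  rw [permuteClasses_mk, permuteClasses_mk, fubiniStudy_mk, fubiniStudy_mk]
  simp

lemma permuteMonomials_mem_traceKernel_iff (σ : Equiv.Perm L) {F : HardySpace L} :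
    permuteMonomials σ F ∈ traceKernel L ↔ F ∈ traceKernel L := by
  change (Summable (fun α => ‖coeff (permuteMonomials σ F) α‖) ∧ _ = _) ↔
    (Summable (fun α => ‖coeff F α‖) ∧ _ = _)
  rw [← σ.summable_iff, ← σ.tsum_eq]
  simp only [Function.comp_def, coeff_permuteMonomials]

lemma permuteClasses_mem_NField_iff (σ : Equiv.Perm L) (p : ℙ ℂ (HardySpace L)) :
    permuteClasses σ p ∈ NField L ↔ p ∈ NField L := by
  induction p using Projectivization.ind with | _ F hF
  rw [permuteClasses_mk, mk_mem_NField_iff, mk_mem_NField_iff,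
    permuteMonomials_mem_traceKernel_iff]

/-- The action of an automorphism of `L` on the sign vectors, by precomposition of the
embeddings. -/
def permuteSigns (σ : L ≃+* L) : Equiv.Perm ((L →+* ℂ) → SignType × SignType) where
  toFun ϑ v := ϑ (v.comp σ)
  invFun ϑ v := ϑ (v.comp σ.symm)
  left_inv ϑ := by funext v; simp [RingHom.comp_assoc]
  right_inv ϑ := by funext v; simp [RingHom.comp_assoc]

omit [CharZero L] in
lemma signVector_apply (σ : L ≃+* L) (α : L) :
    signVector (σ α) = permuteSigns σ (signVector α) := rfl

omit [CharZero L] in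
lemma permuteSigns_mem_signSet_iff (σ : L ≃+* L) (ϑ : (L →+* ℂ) → SignType × SignType) :
    permuteSigns σ ϑ ∈ signSet L ↔ ϑ ∈ signSet L := by
  refine ⟨?_, ?_⟩
  · rintro ⟨α, hα, h⟩
    obtain ⟨β, rfl⟩ := σ.surjective α
    rw [signVector_apply] at h
    exact ⟨β, fun h0 => hα (by rw [h0, map_zero]), (permuteSigns σ).injective h⟩
  · rintro ⟨α, hα, rfl⟩
    exact ⟨σ α, fun h0 => hα (σ.injective (by rw [h0, map_zero])), rfl⟩

lemma permuteMonomials_mem_gradedPart_iff (σ : L ≃+* L) (ϑ : (L →+* ℂ) → SignType × SignType)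
    {F : HardySpace L} : permuteMonomials σ.toEquiv F ∈ gradedPart (permuteSigns σ ϑ) ↔
      F ∈ gradedPart ϑ := by
  change (∀ α, _ → coeff (permuteMonomials σ.toEquiv F) α = 0) ↔ (∀ α, _ → coeff F α = 0)
  rw [← σ.toEquiv.forall_congr_right]
  refine forall_congr' fun α => ?_
  rw [coeff_permuteMonomials]
  change (¬ (σ α ≠ 0 ∧ signVector (σ α) = _) → _) ↔ _
  rw [signVector_apply, (permuteSigns σ).injective.eq_iff, map_ne_zero_iff σ σ.injective]

lemma isGradedIsometry_permuteClasses (σ : L ≃+* L) :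
    IsGradedIsometry (permuteClasses (L := L) σ.toEquiv) where
  isometry := fubiniStudy_permuteClasses _
  graded := by
    refine ⟨(permuteSigns σ).subtypePerm (permuteSigns_mem_signSet_iff σ), fun ϑ => ?_⟩
    ext q
    obtain ⟨p, rfl⟩ := (permuteClasses σ.toEquiv).surjective q
    rw [(permuteClasses σ.toEquiv).injective.mem_set_image]
    induction p using Projectivization.ind with | _ F hF
    rw [permuteClasses_mk]
    exact (mk_rep_mem_iff hF).trans
      ((permuteMonomials_mem_gradedPart_iff σ ϑ.1).symm.trans (mk_rep_mem_iff _).symm)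

lemma IsCauchyProduct.permuteMonomials (σ : L ≃+* L) {F G H : HardySpace L}
    (h : IsCauchyProduct F G H) :
    IsCauchyProduct (permuteMonomials σ.toEquiv F) (permuteMonomials σ.toEquiv G)
      (permuteMonomials σ.toEquiv H) := fun α => by
  obtain ⟨β, rfl⟩ := σ.toEquiv.surjective α
  rw [coeff_permuteMonomials, h, ← σ.toEquiv.tsum_eq (fun γ =>
    coeff (NonlinearNumberField.permuteMonomials σ.toEquiv F) γ *
      coeff (NonlinearNumberField.permuteMonomials σ.toEquiv G) (σ.toEquiv β - γ))]
  refine tsum_congr fun γ => ?_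
  rw [coeff_permuteMonomials, show σ.toEquiv β - σ.toEquiv γ = σ.toEquiv (β - γ) from
    (map_sub σ β γ).symm, coeff_permuteMonomials]

lemma IsDirichletProduct.permuteMonomials (σ : L ≃+* L) {F G H : HardySpace L}
    (h : IsDirichletProduct F G H) :
    IsDirichletProduct (permuteMonomials σ.toEquiv F) (permuteMonomials σ.toEquiv G)
      (permuteMonomials σ.toEquiv H) := by
  let ε : ∀ β : L, {x : L × L // x.1 * x.2 = β} ≃ {x : L × L // x.1 * x.2 = σ.toEquiv β} :=
    fun β => (σ.toEquiv.prodCongr σ.toEquiv).subtypeEquiv fun x => by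
      change _ ↔ σ x.1 * σ x.2 = σ β
      rw [← map_mul, σ.injective.eq_iff]
  have hε : ∀ β (x : {x : L × L // x.1 * x.2 = β}),
      coeff (NonlinearNumberField.permuteMonomials σ.toEquiv F) (ε β x).1.1 *
        coeff (NonlinearNumberField.permuteMonomials σ.toEquiv G) (ε β x).1.2 =
      coeff F x.1.1 * coeff G x.1.2 := fun β x => by
    rw [← coeff_permuteMonomials σ.toEquiv F, ← coeff_permuteMonomials σ.toEquiv G]
    rfl
  refine ⟨?_, fun α => ?_⟩
  · have h0 : σ.toEquiv 0 = 0 := map_zero σ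
    rw [← h0, ← (ε 0).summable_iff]
    simp only [Function.comp_def, hε]
    exact h.1
  · obtain ⟨β, rfl⟩ := σ.toEquiv.surjective α
    rw [coeff_permuteMonomials, h.2, ← (ε β).tsum_eq]
    exact tsum_congr fun x => (hε β x).symm

lemma ProjRel.permuteClasses (σ : Equiv.Perm L)
    {R : HardySpace L → HardySpace L → HardySpace L → Prop}
    (hR : ∀ F G H, R F G H →
      R (permuteMonomials σ F) (permuteMonomials σ G) (permuteMonomials σ H))
    {p q r : ℙ ℂ (HardySpace L)} (h : ProjRel R p q r) :
    ProjRel R (permuteClasses σ p) (permuteClasses σ q) (permuteClasses σ r) := by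
  obtain ⟨F, G, H, hF, hG, hH, rfl, rfl, rfl, h⟩ := h
  exact projRel_mk _ _ _ (hR _ _ _ h)

/-- The permutation of `N_•[L]` induced by `permuteMonomials σ`. -/
def permuteNField (σ : Equiv.Perm L) : Equiv.Perm (NField L) :=
  (permuteClasses σ).subtypePerm (permuteClasses_mem_NField_iff σ)

lemma permuteNField_monomialPoint (σ : Equiv.Perm L) (α : L) :
    permuteNField σ (monomialPoint α) = monomialPoint (σ α) :=
  Subtype.ext (mk_eq_mk _ _ (c := 1) (by
    rw [one_smul]; exact permuteMonomials_monomial σ α))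

lemma isNonlinearAut_permuteNField (σ : L ≃+* L) :
    IsNonlinearAut (permuteNField (L := L) σ.toEquiv) where
  restriction := ⟨_, isGradedIsometry_permuteClasses σ, fun _ => rfl⟩
  cauchy _ _ _ h := ProjRel.permuteClasses (R := IsCauchyProduct) _
    (fun _ _ _ => IsCauchyProduct.permuteMonomials σ) h
  dirichlet _ _ _ h := ProjRel.permuteClasses (R := IsDirichletProduct) _
    (fun _ _ _ => IsDirichletProduct.permuteMonomials σ) h

lemma permuteNField_mem_nonlinearGal {K : Type*} [Field K] [Algebra K L] (σ : L ≃ₐ[K] L) :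
    permuteNField (L := L) σ.toEquiv ∈ nonlinearGal K L := by
  refine ⟨isNonlinearAut_permuteNField σ.toRingEquiv, fun p hp => Subtype.ext ?_⟩
  obtain ⟨p, hpN⟩ := p
  change permuteClasses _ p = p
  have h : NonlinearNumberField.permuteMonomials σ.toEquiv p.rep = p.rep := by
    refine coeff_ext fun α => ?_
    obtain ⟨β, rfl⟩ := σ.toEquiv.surjective α
    rw [coeff_permuteMonomials]
    by_cases hβ : β ∈ Set.range (algebraMap K L)
    · obtain ⟨k, rfl⟩ := hβ
      rw [show σ.toEquiv (algebraMap K L k) = algebraMap K L k from σ.commutes k]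
    · rw [show coeff p.rep β = 0 from hp β hβ]
      refine (hp _ ?_).symm
      rintro ⟨k, hk⟩
      exact hβ ⟨k, σ.injective ((σ.commutes k).trans hk)⟩
  conv_lhs => rw [← Projectivization.mk_rep p]
  rw [permuteClasses_mk, mk_eq_mk _ p.rep_nonzero (c := 1) (by rw [h, one_smul]),
    Projectivization.mk_rep]

end Permutation

end NonlinearNumberField

end

/-- Restriction to the monomials is an isomorphism from the group of nonlinear automorphisms of
`N_•[L]` fixing `N_•[K]` onto the Galois group of `L / K`. -/
theorem mainTheorem1 {K L : Type*} [Field K] [Field L] [CharZero L] [Algebra.IsAlgebraic ℚ L]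
    [Algebra K L] [IsGalois K L] :
    ∃ Φ : NonlinearNumberField.nonlinearGal K L ≃* (L ≃ₐ[K] L),
      ∀ (Υ : NonlinearNumberField.nonlinearGal K L) (α : L),
        Υ.1 (NonlinearNumberField.monomialPoint α) =
          NonlinearNumberField.monomialPoint (Φ Υ α) := by
  choose s hs using fun Υ : NonlinearNumberField.nonlinearGal K L =>
    NonlinearNumberField.exists_algEquiv_apply_monomialPoint Υ.2
  have huniq : ∀ Υ (σ : L ≃ₐ[K] L), (∀ α, Υ.1 (NonlinearNumberField.monomialPoint α) =
      NonlinearNumberField.monomialPoint (σ α)) → s Υ = σ := fun Υ σ h =>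
    AlgEquiv.ext fun α => NonlinearNumberField.monomialPoint_injective (by rw [← hs, h])
  let Φ : NonlinearNumberField.nonlinearGal K L →* (L ≃ₐ[K] L) :=
    { toFun := s
      map_one' := huniq _ _ fun _ => rfl
      map_mul' := fun Υ Υ' => huniq _ _ fun α => by
        rw [Submonoid.coe_mul, Equiv.Perm.mul_apply, hs Υ', hs Υ, AlgEquiv.mul_apply] }
  refine ⟨MulEquiv.ofBijective Φ ⟨fun Υ Υ' h => Subtype.ext ?_, fun σ => ?_⟩, hs⟩
  · refine NonlinearNumberField.eq_of_apply_monomialPoint_eq Υ.2 Υ'.2 (hs Υ) fun α => ?_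
    rw [hs Υ', show s Υ' = s Υ from h.symm]
  · exact ⟨⟨_, NonlinearNumberField.permuteNField_mem_nonlinearGal σ⟩,
      huniq _ _ fun α => NonlinearNumberField.permuteNField_monomialPoint _ α⟩
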